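/- Units: $\hbar=1$. A system (position and momentum $Q,P$) is coupled to two probes ($Q_1,P_1$ and $Q_2,P_2$) by $U=e^{-iH}$ with $H=\lambda QP_1-\mu PQ_2+\tfrac{\lambda\mu}{2}\kappa P_1Q_2$, where $\lambda,\mu>0$ and $\kappa\in\mathbb R$. The system starts in a pure state $\psi\in L^2(\mathbb R)$ with finite position and momentum variance, and the probes start in a state $\sigma$. After the coupling the position of probe 1 and the momentum of probe 2 are measured. Let $\mathsf E^{(\lambda,\mu)}$ be the distribution of the first reading divided by $\lambda$, and $\mathsf F^{(\lambda,\mu)}$ the distribution of the second reading divided by $\mu$. Let $\mathsf E^{(\lambda,0)}$ and $\mathsf F^{(0,\mu)}$ be the same distributions when the coupling is replaced by the one with $\mu=0$, respectively $\lambda=0$. Put $$\mathcal F(Q)=\operatorname{Var}\mathsf E^{(\lambda,\mu)}-\operatorname{Var}\mathsf E^{(\lambda,0)},\qquad \mathcal F(P)=\operatorname{Var}\mathsf F^{(\lambda,\mu)}-\operatorname{Var}\mathsf F^{(0,\mu)}.$$ Joint focusing means that $\mathcal F(Q)<0$ and $\mathcal F(P)<0$. In all cases below the distributions are probability measures with finite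 second moments, and the statements hold for every such $\psi$. (1) Let $D=\begin{pmatrix}a&b\\ b&d\end{pmatrix}$ be a real positive definite matrix and let $\sigma$ be the pure state $\varphi_{12}(q_1,q_2)=\left(\tfrac{4\det D}{\pi^2}\right)^{1/4}\exp\left[-(q_1,q_2)D(q_1,q_2)^T\right]$. Then joint focusing holds if and only if $$|\kappa|>1,\qquad \kappa b>0\qquad\text{and}\qquad \tfrac{\lambda\mu}{4}(1+|\kappa|)<\tfrac{|b|}{a}.$$ Consequently, joint focusing can be achieved with one of the two sign choices $\pm b$ of the off-diagonal entry if and only if $|\kappa|>1$ and $\tfrac{\lambda\mu}{4}(1+|\kappa|)<\tfrac{|b|}{a}$. (2) Let $0<p<1$ and let $\sigma=p\sigma_1+(1-p)\sigma_2$, where each $\sigma_i$ is a pure product of two single-mode Gaussian states, one for each probe, both with mean position $x_i$, mean momentum $k_i$, position variance $S$ and momentum variance $R$ (the same $S,R$ for $i=1,2$). Then $$\operatorname{Cov}(Q_1,Q_2,\sigma)=(p-p^2)(x_1-x_2)^2,\qquad \operatorname{Cov}(P_1,P_2,\sigma)=(p-p^2)(k_1-k_2)^2,$$ and joint focusing implies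 $|\kappa|<1$. Conversely, suppose that $|\kappa|<1$ and $\tfrac{\lambda\mu}{4}(1+|\kappa|)<1$. Then there is a constant $C$, depending only on $\lambda,\mu,\kappa,S,R$, such that joint focusing holds whenever both covariances are at least $C$. In particular there is a constant $L$, depending only on $\lambda,\mu,\kappa,S,R,p$, such that joint focusing holds whenever $|x_1-x_2|\ge L$ and $|k_1-k_2|\ge L$. -/

import Mathlib

open MeasureTheory ProbabilityTheory

namespace ArthursKelly

noncomputable section

/-! Units with `ℏ = 1`.  Configuration space of system and probes: a point `v : ℝ × ℝ × ℝ` is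
`(q, q₁, q₂)` with `q` the system coordinate, `q₁`, `q₂` the coordinates of probes 1 and 2. -/

/-- Directional momentum operator `-i ∂_e` on wave functions of the three particles. -/
def momentumOp (e : ℝ × ℝ × ℝ) (f : ℝ × ℝ × ℝ → ℂ) : ℝ × ℝ × ℝ → ℂ :=
  fun v => -Complex.I * fderiv ℝ f v e

/-- Position operator `Q` of the system. -/
def posSys (f : ℝ × ℝ × ℝ → ℂ) : ℝ × ℝ × ℝ → ℂ := fun v => (v.1 : ℂ) * f v

/-- Position operator `Q₂` of the second probe. -/
def posTwo (f : ℝ × ℝ × ℝ → ℂ) : ℝ × ℝ × ℝ → ℂ := fun v => (v.2.2 : ℂ) * f v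

/-- Momentum operator `P` of the system. -/
def momSys : (ℝ × ℝ × ℝ → ℂ) → (ℝ × ℝ × ℝ → ℂ) := momentumOp (1, 0, 0)

/-- Momentum operator `P₁` of the first probe. -/
def momOne : (ℝ × ℝ × ℝ → ℂ) → (ℝ × ℝ × ℝ → ℂ) := momentumOp (0, 1, 0)

/-- The coupling Hamiltonian `H = λ Q P₁ - μ P Q₂ + (λ μ / 2) κ P₁ Q₂`. -/
def hamiltonian (lam mu kap : ℝ) (f : ℝ × ℝ × ℝ → ℂ) : ℝ × ℝ × ℝ → ℂ :=
  fun v => (lam : ℂ) * posSys (momOne f) v - (mu : ℂ) * momSys (posTwo f) v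
    + ((lam * mu / 2 * kap : ℝ) : ℂ) * momOne (posTwo f) v

/-- The unitary group `exp(-i t H)` in the position representation.  As `-i H` is a linear vector
field, it acts by composition with the flow of this field; `evolve_zero`, `evolve_add` and
`evolve_schrodinger` below show that this is the group with generator `-i H`. -/
def evolve (lam mu kap t : ℝ) (f : ℝ × ℝ × ℝ → ℂ) : ℝ × ℝ × ℝ → ℂ :=
  fun v => f (v.1 + t * mu * v.2.2,
    v.2.1 - t * lam * v.1 - lam * mu / 2 * (t * kap + t ^ 2) * v.2.2, v.2.2)

theorem evolve_zero (lam mu kap : ℝ) (f : ℝ × ℝ × ℝ → ℂ) : evolve lam mu kap 0 f = f := by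
  funext v
  simp [evolve]

theorem evolve_add (lam mu kap s t : ℝ) (f : ℝ × ℝ × ℝ → ℂ) :
    evolve lam mu kap (s + t) f = evolve lam mu kap s (evolve lam mu kap t f) := by
  funext v
  simp only [evolve]
  congr 1
  ext <;> simp only <;> ring

/-- `Ψ_t = evolve t f` solves the Schrödinger equation `dΨ_t/dt = -i H Ψ_t`. -/
theorem evolve_schrodinger (lam mu kap : ℝ) (f : ℝ × ℝ × ℝ → ℂ) (hf : Differentiable ℝ f)
    (t : ℝ) (v : ℝ × ℝ × ℝ) :
    HasDerivAt (fun s => evolve lam mu kap s f v)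
      (-Complex.I * hamiltonian lam mu kap (evolve lam mu kap t f) v) t := by
  have hg : Differentiable ℝ (evolve lam mu kap t f) := by
    unfold evolve
    fun_prop
  have key : ∀ e : ℝ × ℝ × ℝ, fderiv ℝ (evolve lam mu kap t f) v e =
      fderiv ℝ f (v.1 + t * mu * v.2.2,
        v.2.1 - t * lam * v.1 - lam * mu / 2 * (t * kap + t ^ 2) * v.2.2, v.2.2)
        (e.1 + t * mu * e.2.2,
          e.2.1 - t * lam * e.1 - lam * mu / 2 * (t * kap + t ^ 2) * e.2.2, e.2.2) := by
    intro e
    have h1 : HasDerivAt (fun s : ℝ => evolve lam mu kap t f (v + s • e))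
        (fderiv ℝ (evolve lam mu kap t f) v e) 0 := by
      have := (hg v).hasFDerivAt.hasLineDerivAt e
      simpa [HasLineDerivAt] using this
    have h2 : HasDerivAt (fun s : ℝ => (((v + s • e).1 + t * mu * (v + s • e).2.2,
        (v + s • e).2.1 - t * lam * (v + s • e).1
          - lam * mu / 2 * (t * kap + t ^ 2) * (v + s • e).2.2, (v + s • e).2.2) : ℝ × ℝ × ℝ))
        (e.1 + t * mu * e.2.2,
          e.2.1 - t * lam * e.1 - lam * mu / 2 * (t * kap + t ^ 2) * e.2.2, e.2.2) 0 := by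
      have c : ∀ x y : ℝ, HasDerivAt (fun s : ℝ => x + s * y) y 0 := fun x y => by
        simpa using ((hasDerivAt_id (0 : ℝ)).mul_const y).const_add x
      simp only [Prod.fst_add, Prod.snd_add, Prod.smul_fst, Prod.smul_snd, smul_eq_mul]
      exact ((c _ _).add ((c _ _).const_mul _)).prodMk
        ((((c _ _).sub ((c _ _).const_mul _)).sub ((c _ _).const_mul _)).prodMk (c _ _))
    have h3 := (hf _).hasFDerivAt.comp_hasDerivAt (0 : ℝ) h2
    have h4 := h1.unique h3
    simpa using h4
  have hmul : ∀ e : ℝ × ℝ × ℝ, e.2.2 = 0 →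
      fderiv ℝ (posTwo (evolve lam mu kap t f)) v e =
        (v.2.2 : ℂ) * fderiv ℝ (evolve lam mu kap t f) v e := by
    intro e he
    have h1 : HasFDerivAt (fun u : ℝ × ℝ × ℝ => (u.2.2 : ℂ))
        (Complex.ofRealCLM ∘L (ContinuousLinearMap.snd ℝ ℝ ℝ ∘L
          ContinuousLinearMap.snd ℝ ℝ (ℝ × ℝ))) v :=
      ContinuousLinearMap.hasFDerivAt (Complex.ofRealCLM ∘L (ContinuousLinearMap.snd ℝ ℝ ℝ ∘L
          ContinuousLinearMap.snd ℝ ℝ (ℝ × ℝ)))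
    have h2 := (h1.mul (hg v).hasFDerivAt).fderiv
    have h3 : posTwo (evolve lam mu kap t f) =
        (fun u : ℝ × ℝ × ℝ => (u.2.2 : ℂ)) * evolve lam mu kap t f := rfl
    rw [h3, h2]
    simp [he]
  have h2 : HasDerivAt (fun s : ℝ => ((v.1 + s * mu * v.2.2,
      v.2.1 - s * lam * v.1 - lam * mu / 2 * (s * kap + s ^ 2) * v.2.2, v.2.2) : ℝ × ℝ × ℝ))
      (mu * v.2.2, -(lam * v.1) - lam * mu / 2 * (kap + 2 * t) * v.2.2, 0) t := by
    refine HasDerivAt.prodMk ?_ (HasDerivAt.prodMk ?_ (hasDerivAt_const _ _))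
    · simpa using (((hasDerivAt_id t).mul_const mu).mul_const v.2.2).const_add v.1
    · have e1 := (((hasDerivAt_id t).mul_const lam).mul_const v.1).const_sub v.2.1
      have e2 := ((((hasDerivAt_id t).mul_const kap).add ((hasDerivAt_id t).pow 2)).const_mul
        (lam * mu / 2)).mul_const v.2.2
      refine (e1.sub e2).congr_deriv ?_
      simp
  have h3 := (hf _).hasFDerivAt.comp_hasDerivAt t h2
  refine h3.congr_deriv ?_
  simp only [hamiltonian, posSys, momOne, momSys, momentumOp]
  rw [hmul _ rfl, hmul _ rfl, key, key]
  set w : ℝ × ℝ × ℝ := (v.1 + t * mu * v.2.2,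
    v.2.1 - t * lam * v.1 - lam * mu / 2 * (t * kap + t ^ 2) * v.2.2, v.2.2)
  have d1 : ((mu * v.2.2, -(lam * v.1) - lam * mu / 2 * (kap + 2 * t) * v.2.2, 0) : ℝ × ℝ × ℝ)
      = (mu * v.2.2) • ((1, -(t * lam), 0) : ℝ × ℝ × ℝ)
        + (-(lam * v.1) - lam * mu / 2 * kap * v.2.2) • ((0, 1, 0) : ℝ × ℝ × ℝ) := by
    ext <;> simp
    ring
  have hI : Complex.I * Complex.I = -1 := Complex.I_mul_I
  rw [d1, map_add, map_smul, map_smul]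
  simp only [mul_zero, add_zero, mul_one, zero_sub, sub_zero, Complex.real_smul]
  push_cast
  linear_combination ((mu : ℂ) * v.2.2 * fderiv ℝ f w (1, -(t * lam), 0)
    - ((lam : ℂ) * v.1 + lam * mu / 2 * kap * v.2.2) * fderiv ℝ f w (0, 1, 0)) * hI

/-- The state of system and probes after the coupling `U = exp(-i H)`, for a system in the pure
state `ψ` and probes in the pure state `φ`. -/
def coupled (lam mu kap : ℝ) (φ : ℝ × ℝ → ℂ) (ψ : ℝ → ℂ) : ℝ × ℝ × ℝ → ℂ :=
  evolve lam mu kap 1 (fun v => ψ v.1 * φ v.2)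

/-- Unitary Fourier transform in one variable. -/
def fourierOne (f : ℝ → ℂ) (p : ℝ) : ℂ :=
  ((Real.sqrt (2 * Real.pi))⁻¹ : ℝ) * ∫ q : ℝ, Complex.exp (-Complex.I * (p * q : ℝ)) * f q

/-- Unitary Fourier transform in two variables. -/
def fourierTwo (φ : ℝ × ℝ → ℂ) (p : ℝ × ℝ) : ℂ :=
  ((2 * Real.pi)⁻¹ : ℝ) *
    ∫ q : ℝ × ℝ, Complex.exp (-Complex.I * (p.1 * q.1 + p.2 * q.2 : ℝ)) * φ q

/-- The coupled state in the representation `(q, q₁, p₂)`: position for the system and probe 1,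
momentum for probe 2. -/
def coupledMixed (lam mu kap : ℝ) (φ : ℝ × ℝ → ℂ) (ψ : ℝ → ℂ) : ℝ × ℝ × ℝ → ℂ :=
  fun v => fourierOne (fun q₂ => coupled lam mu kap φ ψ (v.1, v.2.1, q₂)) v.2.2

/-- Joint law of the pointer readings (position of probe 1, momentum of probe 2) after the coupling,
with pure probe state `φ`: `X × Y ↦ ⟨Ψ | I ⊗ E^{Q₁}(X) ⊗ E^{P₂}(Y) Ψ⟩`. -/
def purePointerLaw (lam mu kap : ℝ) (φ : ℝ × ℝ → ℂ) (ψ : ℝ → ℂ) : Measure (ℝ × ℝ) :=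
  ((volume : Measure (ℝ × ℝ × ℝ)).withDensity
    (fun v => ‖coupledMixed lam mu kap φ ψ v‖ₑ ^ 2)).map Prod.snd

/-- A preparation of the two probes, `σ = ∑ i, weight i • |wave i⟩⟨wave i|`. -/
structure ProbeEnsemble where
  size : ℕ
  weight : Fin size → ℝ
  wave : Fin size → ℝ × ℝ → ℂ

/-- The pure preparation `|φ⟩⟨φ|`. -/
def ProbeEnsemble.pure (φ : ℝ × ℝ → ℂ) : ProbeEnsemble := ⟨1, ![1], ![φ]⟩

/-- The mixture `p |φ₁⟩⟨φ₁| + (1 - p) |φ₂⟩⟨φ₂|`. -/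
def ProbeEnsemble.mix (p : ℝ) (φ₁ φ₂ : ℝ × ℝ → ℂ) : ProbeEnsemble :=
  ⟨2, ![p, 1 - p], ![φ₁, φ₂]⟩

/-- Joint law of the pointer readings for probes prepared in `σ`. -/
def pointerLaw (lam mu kap : ℝ) (σ : ProbeEnsemble) (ψ : ℝ → ℂ) : Measure (ℝ × ℝ) :=
  ∑ i, ENNReal.ofReal (σ.weight i) • purePointerLaw lam mu kap (σ.wave i) ψ

/-- Outcome distribution, in the system state `ψ`, of the position marginal, where the pointer
reading is rescaled by the coupling constant: `X ↦ ⟨ψ | E^{(λ,μ)}(X) ψ⟩`. -/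
def lawE (lam mu kap : ℝ) (σ : ProbeEnsemble) (ψ : ℝ → ℂ) : Measure ℝ :=
  (pointerLaw lam mu kap σ ψ).map (fun z => z.1 / lam)

/-- Outcome distribution, in the system state `ψ`, of the momentum marginal:
`Y ↦ ⟨ψ | F^{(λ,μ)}(Y) ψ⟩`. -/
def lawF (lam mu kap : ℝ) (σ : ProbeEnsemble) (ψ : ℝ → ℂ) : Measure ℝ :=
  (pointerLaw lam mu kap σ ψ).map (fun z => z.2 / mu)

/-- `𝓕(Q) = Var(E^{(λ,μ)}, ψ) - Var(E^{(λ,0)}, ψ)`: imprecision of the position marginal of the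
joint measurement relative to the measurement by probe 1 alone (coupling with `μ = 0`). -/
def focusQ (lam mu kap : ℝ) (σ : ProbeEnsemble) (ψ : ℝ → ℂ) : ℝ :=
  Var[id; lawE lam mu kap σ ψ] - Var[id; lawE lam 0 kap σ ψ]

/-- `𝓕(P) = Var(F^{(λ,μ)}, ψ) - Var(F^{(0,μ)}, ψ)`: imprecision of the momentum marginal of the
joint measurement relative to the measurement by probe 2 alone (coupling with `λ = 0`). -/
def focusP (lam mu kap : ℝ) (σ : ProbeEnsemble) (ψ : ℝ → ℂ) : ℝ :=
  Var[id; lawF lam mu kap σ ψ] - Var[id; lawF 0 mu kap σ ψ]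

/-- Joint focusing: `𝓕(Q) < 0` and `𝓕(P) < 0`. -/
def JointFocusing (lam mu kap : ℝ) (σ : ProbeEnsemble) (ψ : ℝ → ℂ) : Prop :=
  focusQ lam mu kap σ ψ < 0 ∧ focusP lam mu kap σ ψ < 0

/-- A probability distribution on the line with finite second moment, so that its variance is
meaningful. -/
def HasVariance (m : Measure ℝ) : Prop := IsProbabilityMeasure m ∧ MemLp id 2 m

/-- The four variances that enter `𝓕(Q)` and `𝓕(P)` are those of probability distributions with
finite second moment. -/
def FocusDefined (lam mu kap : ℝ) (σ : ProbeEnsemble) (ψ : ℝ → ℂ) : Prop :=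
  HasVariance (lawE lam mu kap σ ψ) ∧ HasVariance (lawE lam 0 kap σ ψ) ∧
    HasVariance (lawF lam mu kap σ ψ) ∧ HasVariance (lawF 0 mu kap σ ψ)

/-- A pure system state (normalised vector of `L²(ℝ)`) with finite position and momentum variance.
The finite second position moment makes `ψ` integrable, so `fourierOne ψ` is its Fourier
transform. -/
structure IsSystemState (ψ : ℝ → ℂ) : Prop where
  memLp : MemLp ψ 2 volume
  norm_one : ∫ q, ‖ψ q‖ ^ 2 = 1
  pos_moment : Integrable (fun q => q ^ 2 * ‖ψ q‖ ^ 2) volume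
  mom_moment : Integrable (fun p => p ^ 2 * ‖fourierOne ψ p‖ ^ 2) volume

/-- Joint law of `(Q₁, Q₂)` in the probe state `σ`. -/
def positionLaw (σ : ProbeEnsemble) : Measure (ℝ × ℝ) :=
  ∑ i, ENNReal.ofReal (σ.weight i) •
    (volume : Measure (ℝ × ℝ)).withDensity (fun z => ‖σ.wave i z‖ₑ ^ 2)

/-- Joint law of `(P₁, P₂)` in the probe state `σ`. -/
def momentumLaw (σ : ProbeEnsemble) : Measure (ℝ × ℝ) :=
  ∑ i, ENNReal.ofReal (σ.weight i) •
    (volume : Measure (ℝ × ℝ)).withDensity (fun z => ‖fourierTwo (σ.wave i) z‖ₑ ^ 2)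

/-- `Cov(Q₁, Q₂, σ)`. -/
def covQ (σ : ProbeEnsemble) : ℝ := cov[Prod.fst, Prod.snd; positionLaw σ]

/-- `Cov(P₁, P₂, σ)`. -/
def covP (σ : ProbeEnsemble) : ℝ := cov[Prod.fst, Prod.snd; momentumLaw σ]

/-- The unbiased two-mode Gaussian wave function
`(4 det D / π²)^{1/4} exp(-(q₁, q₂) D (q₁, q₂)ᵀ)`. -/
def twoModeGaussian (D : Matrix (Fin 2) (Fin 2) ℝ) (z : ℝ × ℝ) : ℂ :=
  (((4 * D.det / Real.pi ^ 2) ^ (1 / 4 : ℝ) *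
    Real.exp (-(![z.1, z.2] ⬝ᵥ Matrix.mulVec D ![z.1, z.2])) : ℝ) : ℂ)

/-- A normalised pure single-mode Gaussian state: the exponential of a complex quadratic
polynomial. -/
def IsGaussianWave (f : ℝ → ℂ) : Prop :=
  (∃ A B C : ℂ, 0 < A.re ∧ ∀ q : ℝ, f q = Complex.exp (-A * (q : ℂ) ^ 2 + B * (q : ℂ) + C)) ∧
    ∫ q, ‖f q‖ ^ 2 = 1

/-- `φ` is a product of two single-mode Gaussian states, both centred on the phase space point
`(x, k)`, with position variances `S` and momentum variances `R`. -/
structure IsGaussianProduct (x k S R : ℝ) (φ : ℝ × ℝ → ℂ) : Prop where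
  product : ∃ f g : ℝ → ℂ, IsGaussianWave f ∧ IsGaussianWave g ∧ ∀ z, φ z = f z.1 * g z.2
  mean_Q₁ : ∫ z, z.1 ∂(positionLaw (.pure φ)) = x
  mean_Q₂ : ∫ z, z.2 ∂(positionLaw (.pure φ)) = x
  mean_P₁ : ∫ z, z.1 ∂(momentumLaw (.pure φ)) = k
  mean_P₂ : ∫ z, z.2 ∂(momentumLaw (.pure φ)) = k
  var_Q₁ : Var[Prod.fst; positionLaw (.pure φ)] = S
  var_Q₂ : Var[Prod.snd; positionLaw (.pure φ)] = S
  var_P₁ : Var[Prod.fst; momentumLaw (.pure φ)] = R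
  var_P₂ : Var[Prod.snd; momentumLaw (.pure φ)] = R

end

end ArthursKelly

/-! The coupling acts on wave functions by a linear change of coordinates, so the readings are
linear in the initial observables. The first is distributed as λQ + Q₁ + (λμ/2)(κ-1)Q₂ and the
second as μP + P₂ - (λμ/2)(κ+1)P₁, with the system independent of the probes (`lawE_eq`, `lawF_eq`).
The first law follows from Plancherel in the coordinate of probe 2 and a change of variables. For
the second, Plancherel in the system coordinate and in the coordinate of probe 1 passes to the
momentum representation.

Variances of independent variables add, and subtracting the single-probe variance removes everything
that depends on ψ. With t = λμ/4, joint focusing becomes (`jointFocusing_iff`) (κ-1)(t(κ-1) Var Q₂ +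
Cov(Q₁,Q₂)) < 0 and (κ+1)(t(κ+1) Var P₁ - Cov(P₁,P₂)) < 0.

For the two-mode Gaussian with Δ = det D, the Fourier transform replaces D by D⁻¹/4, whence Var Q₂ =
a/(4Δ), Cov(Q₁,Q₂) = -b/(4Δ), Var P₁ = a, Cov(P₁,P₂) = b. The two covariances have opposite signs.
For |κ| ≤ 1 the two inequalities demand opposite signs of b; for |κ| > 1 they demand that b has the
sign of κ, and the stronger of the two is t(1+|κ|)a < |b| (`gaussian_focusing_iff`).

For the mixture both covariances are nonnegative, which forces κ-1 < 0 < κ+1. Since the two probes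
share their means in each component, Var Q₂ = S + Cov(Q₁,Q₂) and Var P₁ = R + Cov(P₁,P₂); for large
covariances S and R are negligible and t(1+|κ|) < 1 suffices (`mixture_focusing_of_le`). -/

namespace ArthursKelly

/-! ### Plancherel's identity for the Fourier integral -/

open FourierTransform in
/-- On `L¹ ∩ L²` the Fourier integral agrees with the Fourier transform on `L²`. -/
theorem fourier_toLp_ae_eq {f : ℝ → ℂ} (h1 : Integrable f) (h2 : MemLp f 2) :
    (𝓕 (h2.toLp f) : Lp ℂ 2 (volume : Measure ℝ)) =ᵐ[volume] 𝓕 f := by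
  refine ae_eq_of_integral_contDiff_smul_eq
    ((Lp.memLp _).locallyIntegrable (by norm_num)) ?_ ?_
  · refine Continuous.locallyIntegrable ?_
    exact VectorFourier.fourierIntegral_continuous Real.continuous_fourierChar
      (by exact continuous_inner) h1
  -- Duality: both transforms are tested against the Schwartz function `G` made from `g`. The hat
  -- moves onto `G` by the distributional definition for one of them and by Fubini for the other.
  · intro g hg hc
    let G : SchwartzMap ℝ ℂ := HasCompactSupport.toSchwartzMap (f := fun x => (g x : ℂ))
      (hc.comp_left (g := fun x : ℝ => (x : ℂ)) (by simp))
      (Complex.ofRealCLM.contDiff.comp hg)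
    have hG : ∀ x, G x = (g x : ℂ) := fun x => rfl
    have e1 := congrArg (fun T => T G) (Lp.fourier_toTemperedDistribution_eq (h2.toLp f))
    simp only [TemperedDistribution.fourier_apply, Lp.toTemperedDistribution_apply] at e1
    have e2 := VectorFourier.integral_fourierIntegral_smul_eq_flip (e := Real.fourierChar)
      (L := innerₗ ℝ) (μ := (volume : Measure ℝ)) (ν := (volume : Measure ℝ)) (f := f) (g := ⇑G)
      Real.continuous_fourierChar (by exact continuous_inner) h1 (G.integrable)
    rw [flip_innerₗ] at e2
    calc ∫ x, g x • (𝓕 (h2.toLp f) : Lp ℂ 2 (volume : Measure ℝ)) x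
        = ∫ x, G x • (𝓕 (h2.toLp f) : Lp ℂ 2 (volume : Measure ℝ)) x := by
          simp [hG]
      _ = ∫ x, (𝓕 G) x • (h2.toLp f) x := e1.symm
      _ = ∫ x, f x • 𝓕 (⇑G) x := by
          refine integral_congr_ae ?_
          filter_upwards [h2.coeFn_toLp] with x hx
          rw [hx, SchwartzMap.fourier_coe, smul_eq_mul, smul_eq_mul, mul_comm]
      _ = ∫ x, 𝓕 f x • G x := e2.symm
      _ = ∫ x, g x • 𝓕 f x := by
          simp [hG, mul_comm]

open FourierTransform in
theorem lintegral_enorm_sq_fourier {f : ℝ → ℂ} (h1 : Integrable f) (h2 : MemLp f 2) :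
    ∫⁻ x, ‖𝓕 f x‖ₑ ^ 2 = ∫⁻ x, ‖f x‖ₑ ^ 2 := by
  have key : eLpNorm (𝓕 f) 2 volume = eLpNorm f 2 volume := by
    rw [← eLpNorm_congr_ae (fourier_toLp_ae_eq h1 h2), ← eLpNorm_congr_ae h2.coeFn_toLp,
      ← Lp.enorm_def, ← Lp.enorm_def, enorm_eq_iff_norm_eq, Lp.norm_fourier_eq]
  have h (g : ℝ → ℂ) : ∫⁻ x, ‖g x‖ₑ ^ 2 = eLpNorm g 2 volume ^ 2 := by
    have := eLpNorm_nnreal_pow_eq_lintegral (f := g) (μ := volume) (p := 2) (by norm_num)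
    simpa using this.symm
  rw [h, h, key]

open FourierTransform in
theorem fourierOne_eq (f : ℝ → ℂ) (p : ℝ) :
    fourierOne f p = ((Real.sqrt (2 * Real.pi))⁻¹ : ℝ) * 𝓕 f (p / (2 * Real.pi)) := by
  rw [fourierOne, Real.fourier_real_eq_integral_exp_smul]
  congr 2
  ext q
  rw [smul_eq_mul]
  congr 2
  push_cast
  have : (Real.pi : ℂ) ≠ 0 := by exact_mod_cast Real.pi_ne_zero
  field_simp

/-- Plancherel's identity for integrable square integrable functions. -/
theorem lintegral_enorm_sq_fourierOne {f : ℝ → ℂ} (h1 : Integrable f) (h2 : MemLp f 2) :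
    ∫⁻ p, ‖fourierOne f p‖ₑ ^ 2 = ∫⁻ x, ‖f x‖ₑ ^ 2 := by
  rw [← lintegral_enorm_sq_fourier h1 h2]
  have hpi : 0 < 2 * Real.pi := by positivity
  set F := fun p => ‖FourierTransform.fourier f p‖ₑ ^ 2 with hF
  have hc : Measurable F := by
    have : Continuous (FourierTransform.fourier f) :=
      VectorFourier.fourierIntegral_continuous Real.continuous_fourierChar
        (by exact continuous_inner) h1
    fun_prop
  have e : ∀ p, ‖fourierOne f p‖ₑ ^ 2 =
      ENNReal.ofReal (2 * Real.pi)⁻¹ * F ((2 * Real.pi)⁻¹ * p) := by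
    intro p
    rw [fourierOne_eq, enorm_mul, mul_pow, hF]
    congr 1
    · rw [← ofReal_norm, ← ENNReal.ofReal_pow (norm_nonneg _)]
      congr 1
      rw [Complex.norm_real, Real.norm_eq_abs, sq_abs, inv_pow, Real.sq_sqrt hpi.le]
    · simp only [div_eq_inv_mul]
  simp_rw [e]
  rw [lintegral_const_mul _ (by fun_prop)]
  have h3 := Real.map_volume_mul_left (a := (2 * Real.pi)⁻¹) (by positivity)
  rw [← lintegral_map (f := F) (g := fun p => (2 * Real.pi)⁻¹ * p) hc (by fun_prop), h3,
    lintegral_smul_measure, smul_eq_mul, ← mul_assoc, ← ENNReal.ofReal_mul (by positivity), inv_inv,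
    abs_of_pos hpi, inv_mul_cancel₀ hpi.ne', ENNReal.ofReal_one, one_mul]

theorem enorm_cexp_neg_I_mul (x : ℝ) : ‖Complex.exp (-Complex.I * (x : ℂ))‖ₑ = 1 := by
  rw [← ofReal_norm, show -Complex.I * (x : ℂ) = ((-x : ℝ) : ℂ) * Complex.I by push_cast; ring,
    Complex.norm_exp_ofReal_mul_I, ENNReal.ofReal_one]

theorem norm_cexp_neg_I_mul (x : ℝ) : ‖Complex.exp (-Complex.I * (x : ℂ))‖ = 1 := by
  rw [show -Complex.I * (x : ℂ) = ((-x : ℝ) : ℂ) * Complex.I by push_cast; ring,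
    Complex.norm_exp_ofReal_mul_I]

/-- Cauchy–Schwarz against the constant function 1. -/
theorem sq_lintegral_le {α : Type*} [MeasurableSpace α] (ν : Measure α) {f : α → ENNReal}
    (hf : AEMeasurable f ν) : (∫⁻ a, f a ∂ν) ^ 2 ≤ ν Set.univ * ∫⁻ a, f a ^ 2 ∂ν := by
  have h := ENNReal.lintegral_mul_le_Lp_mul_Lq ν Real.HolderConjugate.two_two hf
    (g := fun _ => 1) aemeasurable_const
  simp only [Pi.mul_apply, mul_one, ENNReal.rpow_ofNat, one_pow, lintegral_const, one_mul] at h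
  calc _ ≤ _ := pow_le_pow_left' h 2
    _ = _ := by
      rw [mul_pow, ← ENNReal.rpow_natCast, ← ENNReal.rpow_natCast, ← ENNReal.rpow_mul,
        ← ENNReal.rpow_mul]
      norm_num
      rw [mul_comm]

theorem stronglyMeasurable_fourierOne_param {α : Type*} [MeasurableSpace α] {F : α → ℝ → ℂ}
    (hF : StronglyMeasurable (fun z : α × ℝ => F z.1 z.2)) :
    StronglyMeasurable (fun z : α × ℝ => fourierOne (F z.1) z.2) := by
  unfold fourierOne
  refine stronglyMeasurable_const.mul ?_
  refine StronglyMeasurable.integral_prod_right'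
    (f := fun w : (α × ℝ) × ℝ => Complex.exp (-Complex.I * (w.1.2 * w.2 : ℝ)) * F w.1.1 w.2) ?_
  refine StronglyMeasurable.mul ?_ ?_
  · exact (by fun_prop : Continuous (fun u : ℝ × ℝ =>
      Complex.exp (-Complex.I * (u.1 * u.2 : ℝ)))).stronglyMeasurable.comp_measurable
        (g := fun w : (α × ℝ) × ℝ => (w.1.2, w.2)) (by fun_prop)
  · exact hF.comp_measurable (g := fun w : (α × ℝ) × ℝ => (w.1.1, w.2)) (by fun_prop)

theorem continuous_fourierOne {f : ℝ → ℂ} (h1 : Integrable f) : Continuous (fourierOne f) := by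
  have : Continuous (FourierTransform.fourier f) :=
    VectorFourier.fourierIntegral_continuous Real.continuous_fourierChar
      (by exact continuous_inner) h1
  rw [show fourierOne f = _ from funext (fourierOne_eq f)]
  fun_prop

/-! ### Partial Fourier transform of a product sheared by the coupling to probe 2 -/

section shear

variable {ψ χ : ℝ → ℂ}

/-- The phase has modulus one, and for fixed second coordinate the shear is a translation, so the L¹
norm is the product of the two L¹ norms. -/
theorem integrable_shear_mul (hψm : StronglyMeasurable ψ) (hψ : Integrable ψ)
    (hχm : StronglyMeasurable χ) (hχ : Integrable χ) (mu s : ℝ) :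
    Integrable (fun z : ℝ × ℝ =>
      Complex.exp (-Complex.I * (s * z.2 : ℝ)) * (ψ (z.1 + mu * z.2) * χ z.2))
      (volume.prod volume) := by
  have hm : StronglyMeasurable (fun z : ℝ × ℝ =>
      Complex.exp (-Complex.I * (s * z.2 : ℝ)) * (ψ (z.1 + mu * z.2) * χ z.2)) := by
    refine StronglyMeasurable.mul (by fun_prop : Continuous _).stronglyMeasurable ?_
    exact (hψm.comp_measurable (by fun_prop)).mul (hχm.comp_measurable (by fun_prop))
  rw [integrable_prod_iff' hm.aestronglyMeasurable]
  constructor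
  · filter_upwards with y
    exact ((hψ.comp_add_right (mu * y)).mul_const _).const_mul _
  · have : ∀ y, ∫ x, ‖Complex.exp (-Complex.I * (s * y : ℝ)) * (ψ (x + mu * y) * χ y)‖
        = (∫ x, ‖ψ x‖) * ‖χ y‖ := by
      intro y
      simp only [norm_mul, norm_cexp_neg_I_mul, one_mul]
      rw [integral_mul_const, integral_add_right_eq_self (fun x => ‖ψ x‖)]
    simp only [this]
    exact hχ.norm.const_mul _

theorem integrable_fourierOne_shear (hψm : StronglyMeasurable ψ) (hψ : Integrable ψ)
    (hχm : StronglyMeasurable χ) (hχ : Integrable χ) (mu s : ℝ) :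
    Integrable (fun q => fourierOne (fun y => ψ (q + mu * y) * χ y) s) :=
  (integrable_shear_mul hψm hψ hχm hχ mu s).integral_prod_left.const_mul _

/-- Cauchy–Schwarz with respect to the weight |χ| gives |∫ψχ|² ≤ ‖χ‖₁ ∫|ψ|²|χ|, so integrability of
χ is enough; Tonelli and translation invariance then bound the integral over q. -/
theorem memLp_fourierOne_shear (hψm : StronglyMeasurable ψ) (hψ : Integrable ψ)
    (hψ2 : MemLp ψ 2) (hχm : StronglyMeasurable χ) (hχ : Integrable χ) (mu s : ℝ) :
    MemLp (fun q => fourierOne (fun y => ψ (q + mu * y) * χ y) s) 2 := by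
  refine ⟨(integrable_fourierOne_shear hψm hψ hχm hχ mu s).aestronglyMeasurable, ?_⟩
  rw [eLpNorm_lt_top_iff_lintegral_rpow_enorm_lt_top (by norm_num) (by norm_num)]
  simp only [ENNReal.toReal_ofNat, ENNReal.rpow_ofNat]
  have hψm' := hψm.measurable
  have hχm' := hχm.measurable
  have b : ∀ q, ‖fourierOne (fun y => ψ (q + mu * y) * χ y) s‖ₑ ^ 2 ≤
      ‖((Real.sqrt (2 * Real.pi))⁻¹ : ℝ)‖ₑ ^ 2 *
        ((∫⁻ y, ‖χ y‖ₑ) * ∫⁻ y, ‖ψ (q + mu * y)‖ₑ ^ 2 * ‖χ y‖ₑ) := by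
    intro q
    rw [fourierOne, enorm_mul, mul_pow]
    gcongr
    · simp [← ofReal_norm]
    refine (pow_le_pow_left' (enorm_integral_le_lintegral_enorm _) 2).trans ?_
    simp only [enorm_mul, enorm_cexp_neg_I_mul, one_mul]
    have := sq_lintegral_le (volume.withDensity fun y => ‖χ y‖ₑ)
      (f := fun y => ‖ψ (q + mu * y)‖ₑ) (by fun_prop)
    rw [lintegral_withDensity_eq_lintegral_mul _ (by fun_prop) (by fun_prop),
      lintegral_withDensity_eq_lintegral_mul _ (by fun_prop) (by fun_prop),
      withDensity_apply _ MeasurableSet.univ, setLIntegral_univ] at this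
    simpa only [Pi.mul_apply, mul_comm] using this
  refine (lintegral_mono b).trans_lt ?_
  rw [lintegral_const_mul _ (by fun_prop), lintegral_const_mul _ (by fun_prop),
    lintegral_lintegral_swap (by fun_prop)]
  have : ∀ y, ∫⁻ x, ‖ψ (x + mu * y)‖ₑ ^ 2 * ‖χ y‖ₑ = (∫⁻ x, ‖ψ x‖ₑ ^ 2) * ‖χ y‖ₑ := by
    intro y
    rw [lintegral_mul_const _ (by fun_prop),
      lintegral_add_right_eq_self (fun x => ‖ψ x‖ₑ ^ 2)]
  simp only [this]
  rw [lintegral_const_mul _ (by fun_prop)]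
  have h1 : ∫⁻ y, ‖χ y‖ₑ < ⊤ := hχ.2
  have h2 : ∫⁻ y, ‖ψ y‖ₑ ^ 2 < ⊤ := by
    have := (eLpNorm_lt_top_iff_lintegral_rpow_enorm_lt_top (by norm_num) (by norm_num)).1 hψ2.2
    simpa using this
  refine ENNReal.mul_lt_top (ENNReal.pow_lt_top enorm_lt_top) (ENNReal.mul_lt_top h1 (ENNReal.mul_lt_top h2 h1))

/-- The shear q ↦ q + μy is dual to the momentum shift s ↦ s - μp: after translating q by μy the
phases separate and the double integral factors. In momentum representation system and probe are
again in a product, up to this shift. -/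
theorem fourierOne_fourierOne_shear (hψm : StronglyMeasurable ψ) (hψ : Integrable ψ)
    (hχm : StronglyMeasurable χ) (hχ : Integrable χ) (mu s p : ℝ) :
    fourierOne (fun q => fourierOne (fun y => ψ (q + mu * y) * χ y) s) p =
      fourierOne ψ p * fourierOne χ (s - mu * p) := by
  have hi : Integrable (Function.uncurry fun q y : ℝ => Complex.exp (-Complex.I * (p * q : ℝ)) *
      (Complex.exp (-Complex.I * (s * y : ℝ)) * (ψ (q + mu * y) * χ y)))
      (volume.prod volume) := by
    refine (integrable_shear_mul hψm hψ hχm hχ mu s).bdd_mul (c := 1)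
      (f := fun z : ℝ × ℝ => Complex.exp (-Complex.I * (p * z.1 : ℝ)))
      (by fun_prop : Continuous _).aestronglyMeasurable ?_
    filter_upwards with z
    rw [norm_cexp_neg_I_mul]
  set C : ℂ := (((Real.sqrt (2 * Real.pi))⁻¹ : ℝ) : ℂ) with hC
  calc fourierOne (fun q => fourierOne (fun y => ψ (q + mu * y) * χ y) s) p
      = C * (C * ∫ q : ℝ, ∫ y : ℝ, Complex.exp (-Complex.I * (p * q : ℝ)) *
          (Complex.exp (-Complex.I * (s * y : ℝ)) * (ψ (q + mu * y) * χ y))) := by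
        simp only [fourierOne, integral_const_mul, ← hC]
        congr 1
        rw [← integral_const_mul C]
        exact integral_congr_ae (ae_of_all _ fun q => by ring)
    _ = C * (C * ∫ y : ℝ, ∫ q : ℝ, Complex.exp (-Complex.I * (p * q : ℝ)) *
          (Complex.exp (-Complex.I * (s * y : ℝ)) * (ψ (q + mu * y) * χ y))) := by
        rw [integral_integral_swap hi]
    _ = C * (C * ∫ y : ℝ, Complex.exp (-Complex.I * ((s - mu * p) * y : ℝ)) * χ y *
          ∫ q : ℝ, Complex.exp (-Complex.I * (p * q : ℝ)) * ψ q) := by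
        congr 3
        ext y
        rw [← integral_add_right_eq_self
          (fun q : ℝ => Complex.exp (-Complex.I * (p * q : ℝ)) * ψ q) (mu * y),
          ← integral_const_mul]
        congr 1
        ext q
        have : Complex.exp (-Complex.I * (p * q : ℝ)) * Complex.exp (-Complex.I * (s * y : ℝ)) =
            Complex.exp (-Complex.I * ((s - mu * p) * y : ℝ)) *
              Complex.exp (-Complex.I * (p * (q + mu * y) : ℝ)) := by
          rw [← Complex.exp_add, ← Complex.exp_add]
          congr 1
          push_cast
          ring
        linear_combination ψ (q + mu * y) * χ y * this
    _ = _ := by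
        rw [integral_mul_const]
        simp only [fourierOne, ← hC]
        ring

theorem lintegral_enorm_sq_fourierOne_shear (hψm : StronglyMeasurable ψ) (hψ : Integrable ψ)
    (hψ2 : MemLp ψ 2) (hχm : StronglyMeasurable χ) (hχ : Integrable χ) (mu s : ℝ) :
    ∫⁻ q, ‖fourierOne (fun y => ψ (q + mu * y) * χ y) s‖ₑ ^ 2 =
      ∫⁻ p, ‖fourierOne ψ p‖ₑ ^ 2 * ‖fourierOne χ (s - mu * p)‖ₑ ^ 2 := by
  rw [← lintegral_enorm_sq_fourierOne (integrable_fourierOne_shear hψm hψ hχm hχ mu s)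
    (memLp_fourierOne_shear hψm hψ hψ2 hχm hχ mu s)]
  simp only [fourierOne_fourierOne_shear hψm hψ hχm hχ mu s, enorm_mul, mul_pow]

end shear

/-! ### Probe wave functions with Gaussian decay -/

theorem memLp_two_of_bounded {f : ℝ → ℂ} (h : Integrable f) {C : ℝ} (hC : ∀ x, ‖f x‖ ≤ C) :
    MemLp f 2 := by
  rw [memLp_two_iff_integrable_sq_norm h.aestronglyMeasurable]
  refine (h.norm.const_mul C).mono' (h.aestronglyMeasurable.norm.pow 2) (ae_of_all _ fun x => ?_)
  rw [Real.norm_eq_abs, abs_of_nonneg (by positivity), sq]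
  exact mul_le_mul_of_nonneg_right (hC x) (norm_nonneg _)

/-- A continuous two-mode wave function dominated by a Gaussian. -/
structure GaussianDecay (φ : ℝ × ℝ → ℂ) : Prop where
  continuous : Continuous φ
  bound : ∃ K ε : ℝ, 0 < ε ∧ ∀ x y, ‖φ (x, y)‖ ≤ K * (Real.exp (-ε * x ^ 2) * Real.exp (-ε * y ^ 2))

namespace GaussianDecay

variable {φ : ℝ × ℝ → ℂ}

theorem bounded (hφ : GaussianDecay φ) :
    ∃ K ε : ℝ, 0 < ε ∧ ∀ x y, ‖φ (x, y)‖ ≤ K * Real.exp (-ε * y ^ 2) := by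
  obtain ⟨K, ε, hε, h⟩ := hφ.bound
  have hK : 0 ≤ K := by simpa using (norm_nonneg _).trans (h 0 0)
  refine ⟨K, ε, hε, fun x y => (h x y).trans ?_⟩
  refine mul_le_mul_of_nonneg_left ?_ hK
  refine mul_le_of_le_one_left (Real.exp_pos _).le ?_
  rw [Real.exp_le_one_iff]
  nlinarith [sq_nonneg x]

theorem norm_le (hφ : GaussianDecay φ) : ∃ K : ℝ, ∀ z, ‖φ z‖ ≤ K := by
  obtain ⟨K, ε, hε, h⟩ := hφ.bounded
  have hK : 0 ≤ K := by simpa using (norm_nonneg _).trans (h 0 0)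
  refine ⟨K, fun z => (h z.1 z.2).trans (mul_le_of_le_one_right hK ?_)⟩
  rw [Real.exp_le_one_iff]
  nlinarith [sq_nonneg z.2]

theorem integrable_slice (hφ : GaussianDecay φ) (r c : ℝ) :
    Integrable (fun y => φ (r - c * y, y)) := by
  obtain ⟨K, ε, hε, h⟩ := hφ.bounded
  have := hφ.continuous
  exact ((integrable_exp_neg_mul_sq hε).const_mul K).mono'
    (by fun_prop : Continuous _).aestronglyMeasurable (ae_of_all _ fun y => h _ y)

theorem integrable_shear (hφ : GaussianDecay φ) (c s : ℝ) :
    Integrable (fun z : ℝ × ℝ => Complex.exp (-Complex.I * (s * z.2 : ℝ)) *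
      φ (z.1 - c * z.2, z.2)) (volume.prod volume) := by
  obtain ⟨K, ε, hε, h⟩ := hφ.bound
  have hg : Integrable (fun x : ℝ => (Real.exp (-ε * x ^ 2) : ℂ)) :=
    (integrable_exp_neg_mul_sq hε).ofReal
  have hgm : StronglyMeasurable (fun x : ℝ => (Real.exp (-ε * x ^ 2) : ℂ)) :=
    (by fun_prop : Continuous _).stronglyMeasurable
  have hφc := hφ.continuous
  refine ((integrable_shear_mul hgm hg hgm hg (-c) 0).norm.const_mul K).mono'
    (by fun_prop : Continuous _).aestronglyMeasurable (ae_of_all _ fun z => ?_)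
  rw [norm_mul, norm_cexp_neg_I_mul, norm_mul, norm_cexp_neg_I_mul, one_mul, one_mul, norm_mul,
    Complex.norm_real, Complex.norm_real, Real.norm_of_nonneg (Real.exp_pos _).le,
    Real.norm_of_nonneg (Real.exp_pos _).le]
  convert h (z.1 - c * z.2) z.2 using 5
  ring

theorem integrable (hφ : GaussianDecay φ) : Integrable φ (volume.prod volume) := by
  simpa using hφ.integrable_shear 0 0

theorem integrable_fourierOne_slice (hφ : GaussianDecay φ) (c s : ℝ) :
    Integrable (fun r => fourierOne (fun y => φ (r - c * y, y)) s) :=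
  (hφ.integrable_shear c s).integral_prod_left.const_mul _

theorem memLp_fourierOne_slice (hφ : GaussianDecay φ) (c s : ℝ) :
    MemLp (fun r => fourierOne (fun y => φ (r - c * y, y)) s) 2 := by
  obtain ⟨K, ε, hε, h⟩ := hφ.bounded
  refine memLp_two_of_bounded (hφ.integrable_fourierOne_slice c s)
    (C := (Real.sqrt (2 * Real.pi))⁻¹ * ∫ y, K * Real.exp (-ε * y ^ 2)) fun r => ?_
  rw [fourierOne, norm_mul, Complex.norm_real, Real.norm_of_nonneg (by positivity)]
  refine mul_le_mul_of_nonneg_left ?_ (by positivity)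
  refine norm_integral_le_of_norm_le ((integrable_exp_neg_mul_sq hε).const_mul K)
    (ae_of_all _ fun y => ?_)
  rw [norm_mul, norm_cexp_neg_I_mul, one_mul]
  exact h _ _

/-- With x = r - cy the phase pr + sy becomes px + (s + cp)y: a shear in position turns into the
transposed shear in momentum. -/
theorem fourierOne_fourierOne_slice (hφ : GaussianDecay φ) (c s p : ℝ) :
    fourierOne (fun r => fourierOne (fun y => φ (r - c * y, y)) s) p =
      fourierTwo φ (p, s + c * p) := by
  have hi : Integrable (Function.uncurry fun r y : ℝ => Complex.exp (-Complex.I * (p * r : ℝ)) *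
      (Complex.exp (-Complex.I * (s * y : ℝ)) * φ (r - c * y, y))) (volume.prod volume) := by
    refine (hφ.integrable_shear c s).bdd_mul (c := 1)
      (f := fun z : ℝ × ℝ => Complex.exp (-Complex.I * (p * z.1 : ℝ)))
      (by fun_prop : Continuous _).aestronglyMeasurable ?_
    filter_upwards with z
    rw [norm_cexp_neg_I_mul]
  have hi2 : Integrable (fun q : ℝ × ℝ =>
      Complex.exp (-Complex.I * (p * q.1 + (s + c * p) * q.2 : ℝ)) * φ q)
      (volume.prod volume) := by
    refine hφ.integrable.bdd_mul (c := 1) (by fun_prop : Continuous _).aestronglyMeasurable ?_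
    filter_upwards with z
    rw [norm_cexp_neg_I_mul]
  set C : ℂ := (((Real.sqrt (2 * Real.pi))⁻¹ : ℝ) : ℂ) with hC
  have hCC : C * C = (((2 * Real.pi)⁻¹ : ℝ) : ℂ) := by
    rw [hC, ← Complex.ofReal_mul, ← mul_inv, Real.mul_self_sqrt (by positivity)]
  calc fourierOne (fun r => fourierOne (fun y => φ (r - c * y, y)) s) p
      = C * (C * ∫ r : ℝ, ∫ y : ℝ, Complex.exp (-Complex.I * (p * r : ℝ)) *
          (Complex.exp (-Complex.I * (s * y : ℝ)) * φ (r - c * y, y))) := by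
        simp only [fourierOne, integral_const_mul, ← hC]
        congr 1
        rw [← integral_const_mul C]
        exact integral_congr_ae (ae_of_all _ fun q => by ring)
    _ = C * (C * ∫ y : ℝ, ∫ r : ℝ, Complex.exp (-Complex.I * (p * r : ℝ)) *
          (Complex.exp (-Complex.I * (s * y : ℝ)) * φ (r - c * y, y))) := by
        rw [integral_integral_swap hi]
    _ = C * (C * ∫ y : ℝ, ∫ x : ℝ,
          Complex.exp (-Complex.I * (p * x + (s + c * p) * y : ℝ)) * φ (x, y)) := by
        congr 2
        refine integral_congr_ae (ae_of_all _ fun y => ?_)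
        simp only
        rw [← integral_add_right_eq_self (fun r : ℝ => Complex.exp (-Complex.I * (p * r : ℝ)) *
          (Complex.exp (-Complex.I * (s * y : ℝ)) * φ (r - c * y, y))) (c * y)]
        refine integral_congr_ae (ae_of_all _ fun x => ?_)
        simp only [add_sub_cancel_right]
        rw [← mul_assoc, ← Complex.exp_add]
        congr 2
        push_cast
        ring
    _ = _ := by
        rw [fourierTwo, ← hCC, Measure.volume_eq_prod, integral_prod_symm _ hi2, mul_assoc]

theorem lintegral_enorm_sq_fourierOne_slice (hφ : GaussianDecay φ) (c s : ℝ) :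
    ∫⁻ r, ‖fourierOne (fun y => φ (r - c * y, y)) s‖ₑ ^ 2 =
      ∫⁻ p, ‖fourierTwo φ (p, s + c * p)‖ₑ ^ 2 := by
  rw [← lintegral_enorm_sq_fourierOne (hφ.integrable_fourierOne_slice c s)
    (hφ.memLp_fourierOne_slice c s)]
  simp only [hφ.fourierOne_fourierOne_slice]

theorem stronglyMeasurable_fourierTwo (hφ : GaussianDecay φ) :
    StronglyMeasurable (fourierTwo φ) := by
  unfold fourierTwo
  have := hφ.continuous
  refine stronglyMeasurable_const.mul ?_
  refine StronglyMeasurable.integral_prod_right' (f := fun w : (ℝ × ℝ) × (ℝ × ℝ) =>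
    Complex.exp (-Complex.I * (w.1.1 * w.2.1 + w.1.2 * w.2.2 : ℝ)) * φ w.2) ?_
  exact (by fun_prop : Continuous _).stronglyMeasurable

theorem memLp_slice (hφ : GaussianDecay φ) (r c : ℝ) : MemLp (fun y => φ (r - c * y, y)) 2 := by
  obtain ⟨K, hK⟩ := hφ.norm_le
  exact memLp_two_of_bounded (hφ.integrable_slice r c) fun y => hK _

/-- For `mu = 0`, which occurs in the reference measurement, the factor ψ is constant in y and the
decay of φ gives integrability; otherwise ψ is integrable along the line and φ is bounded. -/
theorem integrable_mul_slice (hφ : GaussianDecay φ) {ψ : ℝ → ℂ} (hψ : Integrable ψ)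
    (mu q r c : ℝ) : Integrable (fun y => ψ (q + mu * y) * φ (r - c * y, y)) := by
  rcases eq_or_ne mu 0 with rfl | hmu
  · simpa using (hφ.integrable_slice r c).const_mul (ψ q)
  · obtain ⟨K, hK⟩ := hφ.norm_le
    exact Integrable.mul_bdd (c := K) ((hψ.comp_add_left q).comp_mul_left' hmu)
      (hφ.integrable_slice r c).aestronglyMeasurable (ae_of_all _ fun y => hK _)

theorem memLp_mul_slice (hφ : GaussianDecay φ) {ψ : ℝ → ℂ} (hψ : Integrable ψ)
    (hψ2 : MemLp ψ 2) (mu q r c : ℝ) :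
    MemLp (fun y => ψ (q + mu * y) * φ (r - c * y, y)) 2 := by
  rcases eq_or_ne mu 0 with rfl | hmu
  · simpa using (hφ.memLp_slice r c).const_mul (ψ q)
  · obtain ⟨K, hK⟩ := hφ.norm_le
    have h1 : Integrable (fun y => ψ (q + mu * y)) := (hψ.comp_add_left q).comp_mul_left' hmu
    have h2 : MemLp (fun y => ψ (q + mu * y)) 2 := by
      rw [memLp_two_iff_integrable_sq_norm h1.aestronglyMeasurable]
      rw [memLp_two_iff_integrable_sq_norm hψ.aestronglyMeasurable] at hψ2
      exact (hψ2.comp_add_left q).comp_mul_left' hmu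
    refine h2.of_le_mul (c := K) (hφ.integrable_mul_slice hψ mu q r c).aestronglyMeasurable
      (ae_of_all _ fun y => ?_)
    rw [norm_mul, mul_comm]
    exact mul_le_mul_of_nonneg_right (hK _) (norm_nonneg _)

end GaussianDecay

/-! ### The coupled state and the laws of the two pointer readings -/

theorem coupled_apply (lam mu kap : ℝ) (φ : ℝ × ℝ → ℂ) (ψ : ℝ → ℂ) (q x y : ℝ) :
    coupled lam mu kap φ ψ (q, x, y) =
      ψ (q + mu * y) * φ (x - lam * q - lam * mu / 2 * (kap + 1) * y, y) := by
  simp [coupled, evolve]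

theorem coupledMixed_apply (lam mu kap : ℝ) (φ : ℝ × ℝ → ℂ) (ψ : ℝ → ℂ) (v : ℝ × ℝ × ℝ) :
    coupledMixed lam mu kap φ ψ v = fourierOne (fun y =>
      ψ (v.1 + mu * y) * φ (v.2.1 - lam * v.1 - lam * mu / 2 * (kap + 1) * y, y)) v.2.2 := by
  simp only [coupledMixed, coupled_apply]

section

variable {φ : ℝ × ℝ → ℂ} {ψ : ℝ → ℂ}

theorem measurable_coupledMixed (lam mu kap : ℝ) (hψm : StronglyMeasurable ψ)
    (hφ : GaussianDecay φ) : Measurable (coupledMixed lam mu kap φ ψ) := by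
  rw [show coupledMixed lam mu kap φ ψ = _ from funext (coupledMixed_apply lam mu kap φ ψ)]
  have h := stronglyMeasurable_fourierOne_param (α := ℝ × ℝ) (F := fun w y =>
    ψ (w.1 + mu * y) * φ (w.2 - lam * w.1 - lam * mu / 2 * (kap + 1) * y, y)) ?_
  · exact h.measurable.comp (g := _) (f := fun v : ℝ × ℝ × ℝ => ((v.1, v.2.1), v.2.2))
      (by fun_prop)
  · have := hφ.continuous
    exact (hψm.comp_measurable (by fun_prop)).mul (by fun_prop : Continuous _).stronglyMeasurable

/-- The weight ignores the momentum of probe 2, so Plancherel returns to the coordinate y. The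
substitutions x ↦ x + λq + cy and q ↦ u - μy then make the density a product; the second one turns
κ+1 into κ-1. -/
theorem lintegral_mul_enorm_sq_coupledMixed_fst (lam mu kap : ℝ) (hψm : StronglyMeasurable ψ)
    (hψ : Integrable ψ) (hψ2 : MemLp ψ 2) (hφ : GaussianDecay φ) {h : ℝ → ENNReal}
    (hh : Measurable h) :
    ∫⁻ v, h v.2.1 * ‖coupledMixed lam mu kap φ ψ v‖ₑ ^ 2 =
      ∫⁻ u, ∫⁻ y, ∫⁻ x, h (lam * u + x + lam * mu / 2 * (kap - 1) * y) *
        (‖ψ u‖ₑ ^ 2 * ‖φ (x, y)‖ₑ ^ 2) := by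
  have hm := measurable_coupledMixed lam mu kap hψm hφ
  have hψm' := hψm.measurable
  have hφm := hφ.continuous.measurable
  set c := lam * mu / 2 * (kap + 1) with hc
  calc ∫⁻ v, h v.2.1 * ‖coupledMixed lam mu kap φ ψ v‖ₑ ^ 2
      = ∫⁻ q, ∫⁻ x, ∫⁻ p, h x * ‖coupledMixed lam mu kap φ ψ (q, x, p)‖ₑ ^ 2 := by
        rw [Measure.volume_eq_prod, lintegral_prod _ (by fun_prop)]
        refine lintegral_congr fun q => ?_
        rw [Measure.volume_eq_prod, lintegral_prod _ (by fun_prop)]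
    _ = ∫⁻ q, ∫⁻ x, ∫⁻ y, h x *
          (‖ψ (q + mu * y)‖ₑ ^ 2 * ‖φ (x - lam * q - c * y, y)‖ₑ ^ 2) := by
        refine lintegral_congr fun q => lintegral_congr fun x => ?_
        rw [lintegral_const_mul _ (by fun_prop), lintegral_const_mul _ (by fun_prop)]
        simp only [coupledMixed_apply]
        rw [lintegral_enorm_sq_fourierOne (hφ.integrable_mul_slice hψ _ _ _ _)
          (hφ.memLp_mul_slice hψ hψ2 _ _ _ _)]
        simp only [enorm_mul, mul_pow, hc]
    _ = ∫⁻ q, ∫⁻ y, ∫⁻ x, h (x + (lam * q + c * y)) *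
          (‖ψ (q + mu * y)‖ₑ ^ 2 * ‖φ (x, y)‖ₑ ^ 2) := by
        refine lintegral_congr fun q => ?_
        rw [lintegral_lintegral_swap (by fun_prop)]
        refine lintegral_congr fun y => ?_
        rw [← lintegral_add_right_eq_self _ (lam * q + c * y)]
        refine lintegral_congr fun x => ?_
        ring_nf
    _ = ∫⁻ y, ∫⁻ u, ∫⁻ x, h (lam * u + x + lam * mu / 2 * (kap - 1) * y) *
        (‖ψ u‖ₑ ^ 2 * ‖φ (x, y)‖ₑ ^ 2) := by
        rw [lintegral_lintegral_swap (by fun_prop)]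
        refine lintegral_congr fun y => ?_
        rw [← lintegral_add_right_eq_self _ (-(mu * y))]
        refine lintegral_congr fun u => lintegral_congr fun x => ?_
        rw [hc, neg_add_cancel_right]
        ring_nf
    _ = _ := lintegral_lintegral_swap (by fun_prop)

/-- The weight ignores q and the coordinate of probe 1, so both can be traded for momenta:
Plancherel in q separates ψ from φ, and Plancherel in x completes the two-variable transform of φ.
-/
theorem lintegral_mul_enorm_sq_coupledMixed_snd (lam mu kap : ℝ) (hψm : StronglyMeasurable ψ)
    (hψ : Integrable ψ) (hψ2 : MemLp ψ 2) (hφ : GaussianDecay φ) {h : ℝ → ENNReal}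
    (hh : Measurable h) :
    ∫⁻ v, h v.2.2 * ‖coupledMixed lam mu kap φ ψ v‖ₑ ^ 2 =
      ∫⁻ p, ∫⁻ x, ∫⁻ y, h (mu * p + y - lam * mu / 2 * (kap + 1) * x) *
        (‖fourierOne ψ p‖ₑ ^ 2 * ‖fourierTwo φ (x, y)‖ₑ ^ 2) := by
  have hm := measurable_coupledMixed lam mu kap hψm hφ
  have hψm' := (continuous_fourierOne hψ).measurable
  have hφm := hφ.stronglyMeasurable_fourierTwo.measurable
  have hφc := hφ.continuous
  set c := lam * mu / 2 * (kap + 1) with hc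
  have hχ : Measurable (fun z : ℝ × ℝ => fourierOne (fun y => φ (z.1 - c * y, y)) z.2) :=
    (stronglyMeasurable_fourierOne_param (F := fun r y => φ (r - c * y, y))
      (by fun_prop : Continuous _).stronglyMeasurable).measurable
  have hG : Measurable (fun z : (ℝ × ℝ) × ℝ =>
      fourierOne (fun y => ψ (z.1.1 + mu * y) * φ (z.1.2 - c * y, y)) z.2) :=
    (stronglyMeasurable_fourierOne_param (α := ℝ × ℝ)
      (F := fun r y => ψ (r.1 + mu * y) * φ (r.2 - c * y, y))
      ((hψm.comp_measurable (by fun_prop)).mul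
        (by fun_prop : Continuous _).stronglyMeasurable)).measurable
  calc ∫⁻ v, h v.2.2 * ‖coupledMixed lam mu kap φ ψ v‖ₑ ^ 2
      = ∫⁻ q, ∫⁻ x, ∫⁻ s, h s * ‖coupledMixed lam mu kap φ ψ (q, x, s)‖ₑ ^ 2 := by
        rw [Measure.volume_eq_prod, lintegral_prod _ (by fun_prop)]
        refine lintegral_congr fun q => ?_
        rw [Measure.volume_eq_prod, lintegral_prod _ (by fun_prop)]
    _ = ∫⁻ q, ∫⁻ s, ∫⁻ x, h s *
          ‖fourierOne (fun y => ψ (q + mu * y) * φ (x - c * y, y)) s‖ₑ ^ 2 := by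
        refine lintegral_congr fun q => ?_
        rw [lintegral_lintegral_swap (by fun_prop)]
        refine lintegral_congr fun s => ?_
        -- Translating x by λq removes the action of λQP₁, which does not affect the momentum of
        -- probe 2 once x is integrated out.
        rw [← lintegral_add_right_eq_self _ (lam * q)]
        refine lintegral_congr fun x => ?_
        simp only [coupledMixed_apply, add_sub_cancel_right, hc]
    _ = ∫⁻ s, ∫⁻ x, ∫⁻ q, h s *
          ‖fourierOne (fun y => ψ (q + mu * y) * φ (x - c * y, y)) s‖ₑ ^ 2 := by
        rw [lintegral_lintegral_swap]
        · refine lintegral_congr fun s => ?_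
          rw [lintegral_lintegral_swap]
          exact (((hG.comp (f := fun w : ℝ × ℝ => ((w.1, w.2), s)) (by fun_prop)).enorm.pow_const
            2).const_mul _).aemeasurable
        · refine (Measurable.lintegral_prod_right' (f := fun w : (ℝ × ℝ) × ℝ => h w.1.2 *
            ‖fourierOne (fun y => ψ (w.1.1 + mu * y) * φ (w.2 - c * y, y)) w.1.2‖ₑ ^ 2)
            ?_).aemeasurable
          exact (hh.comp (by fun_prop)).mul
            ((hG.comp (f := fun w : (ℝ × ℝ) × ℝ => ((w.1.1, w.2), w.1.2))
              (by fun_prop)).enorm.pow_const 2)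
    _ = ∫⁻ s, ∫⁻ p, ∫⁻ x, h s * (‖fourierOne ψ p‖ₑ ^ 2 *
          ‖fourierOne (fun y => φ (x - c * y, y)) (s - mu * p)‖ₑ ^ 2) := by
        refine lintegral_congr fun s => ?_
        symm
        rw [lintegral_lintegral_swap]
        · refine lintegral_congr fun x => ?_
          have hl : Measurable fun p : ℝ =>
              ‖fourierOne (fun y => φ (x - c * y, y)) (s - mu * p)‖ₑ ^ 2 :=
            (hχ.comp (f := fun p : ℝ => (x, s - mu * p)) (by fun_prop)).enorm.pow_const 2
          rw [lintegral_const_mul _ (by fun_prop), ← lintegral_enorm_sq_fourierOne_shear hψm hψ hψ2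
            (by fun_prop : Continuous fun y => φ (x - c * y, y)).stronglyMeasurable
            (hφ.integrable_slice x c), lintegral_const_mul]
          exact (hG.comp (f := fun q : ℝ => ((q, x), s)) (by fun_prop)).enorm.pow_const 2
        · refine (((hψm'.comp measurable_fst).enorm.pow_const 2).mul
            ((hχ.comp (f := fun w : ℝ × ℝ => (w.2, s - mu * w.1))
              (by fun_prop)).enorm.pow_const 2)).const_mul _ |>.aemeasurable
    _ = ∫⁻ s, ∫⁻ p, ∫⁻ x, h s * (‖fourierOne ψ p‖ₑ ^ 2 *
          ‖fourierTwo φ (x, s - mu * p + c * x)‖ₑ ^ 2) := by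
        refine lintegral_congr fun s => lintegral_congr fun p => ?_
        rw [lintegral_const_mul, lintegral_const_mul,
          hφ.lintegral_enorm_sq_fourierOne_slice, ← lintegral_const_mul, ← lintegral_const_mul]
        · fun_prop
        · fun_prop
        · exact (hχ.comp (f := fun x : ℝ => (x, s - mu * p)) (by fun_prop)).enorm.pow_const 2
        · exact ((hχ.comp (f := fun x : ℝ => (x, s - mu * p))
            (by fun_prop)).enorm.pow_const 2).const_mul _
    _ = ∫⁻ p, ∫⁻ x, ∫⁻ s, h s * (‖fourierOne ψ p‖ₑ ^ 2 *
          ‖fourierTwo φ (x, s - mu * p + c * x)‖ₑ ^ 2) := by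
        rw [lintegral_lintegral_swap (by fun_prop)]
        refine lintegral_congr fun p => ?_
        rw [lintegral_lintegral_swap (by fun_prop)]
    _ = _ := by
        refine lintegral_congr fun p => lintegral_congr fun x => ?_
        rw [← lintegral_add_right_eq_self _ (mu * p - c * x)]
        refine lintegral_congr fun y => ?_
        ring_nf

end

/-! ### Born laws of the system and independence of the chosen representative -/

noncomputable section

/-- The measure with density `|f|²`. -/
def bornLaw (f : ℝ → ℂ) : Measure ℝ := volume.withDensity fun q => ‖f q‖ₑ ^ 2

instance (f : ℝ → ℂ) : SFinite (bornLaw f) := by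
  unfold bornLaw
  infer_instance

theorem lintegral_bornLaw {f : ℝ → ℂ} (hf : AEStronglyMeasurable f) {h : ℝ → ENNReal}
    (hh : Measurable h) : ∫⁻ q, h q ∂bornLaw f = ∫⁻ q, ‖f q‖ₑ ^ 2 * h q :=
  lintegral_withDensity_eq_lintegral_mul₀ (hf.enorm.pow_const 2) hh.aemeasurable

theorem integrable_bornLaw_iff {f : ℝ → ℂ} (hf : AEStronglyMeasurable f) {g : ℝ → ℝ} :
    Integrable g (bornLaw f) ↔ Integrable (fun q => g q * ‖f q‖ ^ 2) := by
  unfold bornLaw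
  rw [integrable_withDensity_iff_integrable_smul₀' (hf.enorm.pow_const 2)
    (ae_of_all _ fun q => ENNReal.pow_lt_top enorm_lt_top)]
  simp only [ENNReal.toReal_pow, toReal_enorm, smul_eq_mul, mul_comm]

theorem bornLaw_congr {f g : ℝ → ℂ} (h : f =ᵐ[volume] g) : bornLaw f = bornLaw g :=
  withDensity_congr_ae (h.mono fun q hq => by simp only [hq])

theorem isProbabilityMeasure_bornLaw {f : ℝ → ℂ} (hf : ∫⁻ q, ‖f q‖ₑ ^ 2 = 1) :
    IsProbabilityMeasure (bornLaw f) :=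
  ⟨by rw [bornLaw, withDensity_apply _ MeasurableSet.univ, setLIntegral_univ, hf]⟩

theorem memLp_id_bornLaw {f : ℝ → ℂ} (hf : AEStronglyMeasurable f)
    (h : Integrable fun q => q ^ 2 * ‖f q‖ ^ 2) : MemLp id 2 (bornLaw f) := by
  rw [memLp_two_iff_integrable_sq measurable_id.aestronglyMeasurable]
  exact (integrable_bornLaw_iff hf).2 h

theorem lintegral_enorm_sq_eq_one {f : ℝ → ℂ} (hf : AEStronglyMeasurable f)
    (h : ∫ q, ‖f q‖ ^ 2 = 1) : ∫⁻ q, ‖f q‖ₑ ^ 2 = 1 := by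
  rw [integral_eq_lintegral_of_nonneg_ae (ae_of_all _ fun q => by positivity)
    (hf.norm.aemeasurable.pow_const 2).aestronglyMeasurable] at h
  rw [ENNReal.toReal_eq_one_iff] at h
  rw [← h]
  refine lintegral_congr fun q => ?_
  rw [ENNReal.ofReal_pow (norm_nonneg _), ofReal_norm]

namespace IsSystemState

variable {ψ : ℝ → ℂ}

theorem integrable (h : IsSystemState ψ) : Integrable ψ := by
  have h2 := (memLp_two_iff_integrable_sq_norm h.memLp.1).1 h.memLp
  refine ((h2.add h.pos_moment).add integrable_inv_one_add_sq).mono' h.memLp.1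
    (ae_of_all _ fun q => ?_)
  have hq : 0 < 1 + q ^ 2 := by positivity
  simp only [Pi.add_apply]
  -- With s = ‖ψ q‖(1 + q²) this is s² + 1 - s = (s - 1/2)² + 3/4, divided by 1 + q².
  have e : ‖ψ q‖ ^ 2 + q ^ 2 * ‖ψ q‖ ^ 2 + (1 + q ^ 2)⁻¹ - ‖ψ q‖ =
      ((‖ψ q‖ * (1 + q ^ 2) - 1 / 2) ^ 2 + 3 / 4) / (1 + q ^ 2) := by
    field_simp
    ring
  have : 0 ≤ ((‖ψ q‖ * (1 + q ^ 2) - 1 / 2) ^ 2 + 3 / 4) / (1 + q ^ 2) := by positivity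
  linarith

theorem isProbabilityMeasure_pos (h : IsSystemState ψ) : IsProbabilityMeasure (bornLaw ψ) :=
  isProbabilityMeasure_bornLaw (lintegral_enorm_sq_eq_one h.memLp.1 h.norm_one)

theorem memLp_pos (h : IsSystemState ψ) : MemLp id 2 (bornLaw ψ) :=
  memLp_id_bornLaw h.memLp.1 h.pos_moment

theorem isProbabilityMeasure_mom (h : IsSystemState ψ) :
    IsProbabilityMeasure (bornLaw (fourierOne ψ)) :=
  isProbabilityMeasure_bornLaw (by
    rw [lintegral_enorm_sq_fourierOne h.integrable h.memLp,
      lintegral_enorm_sq_eq_one h.memLp.1 h.norm_one])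

theorem memLp_mom (h : IsSystemState ψ) : MemLp id 2 (bornLaw (fourierOne ψ)) :=
  memLp_id_bornLaw (continuous_fourierOne h.integrable).aestronglyMeasurable h.mom_moment

end IsSystemState

/-- If `mu ≠ 0`, ψ enters only through an integral along a nondegenerate line, so the mixed
representation agrees at every point. If `mu = 0`, ψ is evaluated at q itself and the agreement is
only almost everywhere. -/
theorem purePointerLaw_congr (lam mu kap : ℝ) (φ : ℝ × ℝ → ℂ) {ψ ψ' : ℝ → ℂ}
    (h : ψ =ᵐ[volume] ψ') : purePointerLaw lam mu kap φ ψ = purePointerLaw lam mu kap φ ψ' := by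
  have key : coupledMixed lam mu kap φ ψ =ᵐ[volume] coupledMixed lam mu kap φ ψ' := by
    rcases eq_or_ne mu 0 with rfl | hmu
    · have h1 : ∀ᵐ v : ℝ × ℝ × ℝ, ψ v.1 = ψ' v.1 :=
        (Measure.quasiMeasurePreserving_fst (μ := (volume : Measure ℝ))
          (ν := (volume : Measure (ℝ × ℝ)))).ae_eq h
      filter_upwards [h1] with v hv
      simp only [coupledMixed_apply, zero_mul, add_zero, hv]
    · refine ae_of_all _ fun v => ?_
      have hq : Measure.QuasiMeasurePreserving (fun y : ℝ => v.1 + mu * y) := by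
        refine (measurePreserving_add_left volume v.1).quasiMeasurePreserving.comp
          (g := fun y => v.1 + y) (f := fun y => mu * y) ⟨by fun_prop, ?_⟩
        rw [Real.map_volume_mul_left hmu]
        exact Measure.smul_absolutelyContinuous
      simp only [coupledMixed_apply, fourierOne]
      congr 1
      refine integral_congr_ae ?_
      filter_upwards [hq.ae_eq h] with y hy
      simp only [Function.comp_apply] at hy
      simp only [hy]
  unfold purePointerLaw
  congr 1
  exact withDensity_congr_ae (key.mono fun v hv => by simp only [hv])

theorem fourierOne_congr {f g : ℝ → ℂ} (h : f =ᵐ[volume] g) : fourierOne f = fourierOne g := by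
  ext p
  unfold fourierOne
  congr 1
  refine integral_congr_ae ?_
  filter_upwards [h] with y hy
  simp only [hy]

section

variable {φ : ℝ × ℝ → ℂ} {ψ : ℝ → ℂ}

theorem lintegral_purePointerLaw_fst (lam mu kap : ℝ) (hψ : IsSystemState ψ)
    (hφ : GaussianDecay φ) {h : ℝ → ENNReal} (hh : Measurable h) :
    ∫⁻ w, h w.1 ∂purePointerLaw lam mu kap φ ψ =
      ∫⁻ u, ∫⁻ z, h (lam * u + z.1 + lam * mu / 2 * (kap - 1) * z.2)
        ∂volume.withDensity (fun z => ‖φ z‖ₑ ^ 2) ∂bornLaw ψ := by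
  have hm := hψ.memLp.1
  set ψ' := hm.mk ψ
  have he : ψ =ᵐ[volume] ψ' := hm.ae_eq_mk
  have hm' : StronglyMeasurable ψ' := hm.stronglyMeasurable_mk
  have hmm := hm'.measurable
  have hφm := hφ.continuous.measurable
  have hc := measurable_coupledMixed lam mu kap hm' hφ
  rw [purePointerLaw_congr lam mu kap φ he, bornLaw_congr he, purePointerLaw,
    lintegral_map (by fun_prop) measurable_snd,
    lintegral_withDensity_eq_lintegral_mul _ (by fun_prop) (by fun_prop)]
  have := lintegral_mul_enorm_sq_coupledMixed_fst lam mu kap hm' (hψ.integrable.congr he)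
    ((memLp_congr_ae he).1 hψ.memLp) hφ hh
  simp only [Pi.mul_apply, mul_comm (‖coupledMixed lam mu kap φ ψ' _‖ₑ ^ 2)]
  rw [this]
  have e : ∀ u, ∫⁻ z, h (lam * u + z.1 + lam * mu / 2 * (kap - 1) * z.2)
      ∂volume.withDensity (fun z => ‖φ z‖ₑ ^ 2) =
      ∫⁻ y, ∫⁻ x, ‖φ (x, y)‖ₑ ^ 2 * h (lam * u + x + lam * mu / 2 * (kap - 1) * y) := by
    intro u
    rw [lintegral_withDensity_eq_lintegral_mul _ (by fun_prop) (by fun_prop),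
      Measure.volume_eq_prod, lintegral_prod_symm _ (by fun_prop)]
    rfl
  simp only [e]
  rw [lintegral_bornLaw hm'.aestronglyMeasurable (by fun_prop)]
  refine lintegral_congr fun u => ?_
  rw [← lintegral_const_mul _ (by fun_prop)]
  refine lintegral_congr fun y => ?_
  rw [← lintegral_const_mul _ (by fun_prop)]
  refine lintegral_congr fun x => ?_
  ring

theorem lintegral_purePointerLaw_snd (lam mu kap : ℝ) (hψ : IsSystemState ψ)
    (hφ : GaussianDecay φ) {h : ℝ → ENNReal} (hh : Measurable h) :
    ∫⁻ w, h w.2 ∂purePointerLaw lam mu kap φ ψ =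
      ∫⁻ p, ∫⁻ z, h (mu * p + z.2 - lam * mu / 2 * (kap + 1) * z.1)
        ∂volume.withDensity (fun z => ‖fourierTwo φ z‖ₑ ^ 2) ∂bornLaw (fourierOne ψ) := by
  have hm := hψ.memLp.1
  set ψ' := hm.mk ψ
  have he : ψ =ᵐ[volume] ψ' := hm.ae_eq_mk
  have hm' : StronglyMeasurable ψ' := hm.stronglyMeasurable_mk
  have hi := hψ.integrable.congr he
  have hmm := (continuous_fourierOne hi).measurable
  have hφm := hφ.stronglyMeasurable_fourierTwo.measurable
  have hc := measurable_coupledMixed lam mu kap hm' hφ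
  rw [purePointerLaw_congr lam mu kap φ he, fourierOne_congr he, purePointerLaw,
    lintegral_map (by fun_prop) measurable_snd,
    lintegral_withDensity_eq_lintegral_mul _ (by fun_prop) (by fun_prop)]
  have := lintegral_mul_enorm_sq_coupledMixed_snd lam mu kap hm' hi
    ((memLp_congr_ae he).1 hψ.memLp) hφ hh
  simp only [Pi.mul_apply, mul_comm (‖coupledMixed lam mu kap φ ψ' _‖ₑ ^ 2)]
  rw [this]
  have e : ∀ p, ∫⁻ z, h (mu * p + z.2 - lam * mu / 2 * (kap + 1) * z.1)
      ∂volume.withDensity (fun z => ‖fourierTwo φ z‖ₑ ^ 2) =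
      ∫⁻ x, ∫⁻ y, ‖fourierTwo φ (x, y)‖ₑ ^ 2 *
        h (mu * p + y - lam * mu / 2 * (kap + 1) * x) := by
    intro u
    rw [lintegral_withDensity_eq_lintegral_mul _ (by fun_prop) (by fun_prop),
      Measure.volume_eq_prod, lintegral_prod _ (by fun_prop)]
    rfl
  simp only [e]
  rw [lintegral_bornLaw hmm.aestronglyMeasurable (by fun_prop)]
  refine lintegral_congr fun u => ?_
  rw [← lintegral_const_mul _ (by fun_prop)]
  refine lintegral_congr fun y => ?_
  rw [← lintegral_const_mul _ (by fun_prop)]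
  refine lintegral_congr fun x => ?_
  ring

end

/-! ### Rescaled readings as sums of independent variables, and their variances -/

section

variable {σ : ProbeEnsemble} {ψ : ℝ → ℂ}

/-- The law of a reading is affine in the probe state, so the pure-state formula extends to
ensembles. `mu = 0` is allowed: the same formula then describes the reference measurement. -/
theorem lawE_eq (hσ : ∀ i, GaussianDecay (σ.wave i)) [SFinite (positionLaw σ)]
    (hψ : IsSystemState ψ) {lam : ℝ} (hlam : lam ≠ 0) (mu kap : ℝ) :
    lawE lam mu kap σ ψ = ((bornLaw ψ).prod (positionLaw σ)).map
      (fun w => w.1 + (w.2.1 + lam * mu / 2 * (kap - 1) * w.2.2) / lam) := by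
  refine Measure.ext_of_lintegral _ fun f hf => ?_
  rw [lawE, lintegral_map hf (by fun_prop), lintegral_map hf (by fun_prop),
    lintegral_prod _ (by fun_prop), pointerLaw, lintegral_finsetSum_measure]
  simp only [positionLaw, lintegral_finsetSum_measure, lintegral_smul_measure, smul_eq_mul]
  rw [lintegral_finsetSum]
  · refine Finset.sum_congr rfl fun i _ => ?_
    have h1 := lintegral_purePointerLaw_fst lam mu kap hψ (hσ i)
      (h := fun t => f (t / lam)) (by fun_prop)
    rw [h1, lintegral_const_mul]
    · congr 1
      refine lintegral_congr fun u => lintegral_congr fun z => ?_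
      congr 1
      field_simp
      ring
    · exact Measurable.lintegral_prod_right' (f := fun w : ℝ × ℝ × ℝ =>
        f (w.1 + (w.2.1 + lam * mu / 2 * (kap - 1) * w.2.2) / lam)) (by fun_prop)
  · exact fun i _ => (Measurable.lintegral_prod_right' (f := fun w : ℝ × ℝ × ℝ =>
        f (w.1 + (w.2.1 + lam * mu / 2 * (kap - 1) * w.2.2) / lam)) (by fun_prop)).const_mul _

theorem lawF_eq (hσ : ∀ i, GaussianDecay (σ.wave i)) [SFinite (momentumLaw σ)]
    (hψ : IsSystemState ψ) {mu : ℝ} (hmu : mu ≠ 0) (lam kap : ℝ) :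
    lawF lam mu kap σ ψ = ((bornLaw (fourierOne ψ)).prod (momentumLaw σ)).map
      (fun w => w.1 + (w.2.2 + -(lam * mu / 2 * (kap + 1)) * w.2.1) / mu) := by
  refine Measure.ext_of_lintegral _ fun f hf => ?_
  rw [lawF, lintegral_map hf (by fun_prop), lintegral_map hf (by fun_prop),
    lintegral_prod _ (by fun_prop), pointerLaw, lintegral_finsetSum_measure]
  simp only [momentumLaw, lintegral_finsetSum_measure, lintegral_smul_measure, smul_eq_mul]
  rw [lintegral_finsetSum]
  · refine Finset.sum_congr rfl fun i _ => ?_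
    have h1 := lintegral_purePointerLaw_snd lam mu kap hψ (hσ i)
      (h := fun t => f (t / mu)) (by fun_prop)
    rw [h1, lintegral_const_mul]
    · congr 1
      refine lintegral_congr fun u => lintegral_congr fun z => ?_
      congr 1
      field_simp
      ring
    · exact Measurable.lintegral_prod_right' (f := fun w : ℝ × ℝ × ℝ =>
        f (w.1 + (w.2.2 + -(lam * mu / 2 * (kap + 1)) * w.2.1) / mu)) (by fun_prop)
  · exact fun i _ => (Measurable.lintegral_prod_right' (f := fun w : ℝ × ℝ × ℝ =>
        f (w.1 + (w.2.2 + -(lam * mu / 2 * (kap + 1)) * w.2.1) / mu)) (by fun_prop)).const_mul _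

end

/-- A probability measure on the plane with finite second moments. -/
structure HasSecondMoments (ν : Measure (ℝ × ℝ)) : Prop where
  isProb : IsProbabilityMeasure ν
  fst : MemLp Prod.fst 2 ν
  snd : MemLp Prod.snd 2 ν

theorem hasVariance_map_prod {μ : Measure ℝ} {ν : Measure (ℝ × ℝ)} [IsProbabilityMeasure μ]
    [IsProbabilityMeasure ν] (hμ : MemLp id 2 μ) {Y : ℝ × ℝ → ℝ} (hYm : Measurable Y)
    (hY : MemLp Y 2 ν) :
    HasVariance ((μ.prod ν).map fun w => w.1 + Y w.2) ∧
      Var[id; (μ.prod ν).map fun w => w.1 + Y w.2] = Var[id; μ] + Var[Y; ν] := by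
  have hm : AEMeasurable (fun w : ℝ × ℝ × ℝ => w.1 + Y w.2) (μ.prod ν) := by fun_prop
  refine ⟨⟨Measure.isProbabilityMeasure_map hm, ?_⟩, ?_⟩
  · rw [memLp_map_measure_iff measurable_id.aestronglyMeasurable hm, Function.id_comp]
    have h1 : MemLp (fun w : ℝ × ℝ × ℝ => w.1) 2 (μ.prod ν) :=
      hμ.comp_measurePreserving measurePreserving_fst
    have h2 : MemLp (fun w : ℝ × ℝ × ℝ => Y w.2) 2 (μ.prod ν) :=
      hY.comp_measurePreserving measurePreserving_snd
    exact h1.add h2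
  · rw [variance_map measurable_id.aemeasurable hm, Function.id_comp]
    exact variance_add_prod (X := id) (Y := Y) hμ hY

theorem variance_add_const_mul_div {ν : Measure (ℝ × ℝ)} [IsProbabilityMeasure ν]
    {X Y : ℝ × ℝ → ℝ} (hX : MemLp X 2 ν) (hY : MemLp Y 2 ν) (m l : ℝ) :
    Var[fun z => (X z + m * Y z) / l; ν] =
      (Var[X; ν] + 2 * m * cov[X, Y; ν] + m ^ 2 * Var[Y; ν]) / l ^ 2 := by
  have e : (fun z => (X z + m * Y z) / l) = fun z => l⁻¹ * (X z + m * Y z) := by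
    ext z
    ring
  rw [e, variance_const_mul, variance_fun_add hX (hY.const_mul m), variance_const_mul,
    covariance_const_mul_right]
  ring

section

variable {σ : ProbeEnsemble} {ψ : ℝ → ℂ}

theorem lawE_variance (hσ : ∀ i, GaussianDecay (σ.wave i))
    (hq : HasSecondMoments (positionLaw σ)) (hψ : IsSystemState ψ) {lam : ℝ} (hlam : lam ≠ 0)
    (mu kap : ℝ) :
    HasVariance (lawE lam mu kap σ ψ) ∧
      Var[id; lawE lam mu kap σ ψ] = Var[id; bornLaw ψ] +
        (Var[Prod.fst; positionLaw σ] + 2 * (lam * mu / 2 * (kap - 1)) * covQ σ +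
          (lam * mu / 2 * (kap - 1)) ^ 2 * Var[Prod.snd; positionLaw σ]) / lam ^ 2 := by
  have := hψ.isProbabilityMeasure_pos
  have := hq.isProb
  have hY : MemLp (fun z : ℝ × ℝ => (z.1 + lam * mu / 2 * (kap - 1) * z.2) / lam) 2
      (positionLaw σ) := by
    simp only [div_eq_mul_inv]
    exact (hq.fst.add (hq.snd.const_mul _)).mul_const _
  rw [lawE_eq hσ hψ hlam, covQ, ← variance_add_const_mul_div hq.fst hq.snd]
  exact hasVariance_map_prod hψ.memLp_pos (by fun_prop) hY

theorem lawF_variance (hσ : ∀ i, GaussianDecay (σ.wave i))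
    (hp : HasSecondMoments (momentumLaw σ)) (hψ : IsSystemState ψ) {mu : ℝ} (hmu : mu ≠ 0)
    (lam kap : ℝ) :
    HasVariance (lawF lam mu kap σ ψ) ∧
      Var[id; lawF lam mu kap σ ψ] = Var[id; bornLaw (fourierOne ψ)] +
        (Var[Prod.snd; momentumLaw σ] + 2 * -(lam * mu / 2 * (kap + 1)) * covP σ +
          (-(lam * mu / 2 * (kap + 1))) ^ 2 * Var[Prod.fst; momentumLaw σ]) / mu ^ 2 := by
  have := hψ.isProbabilityMeasure_mom
  have := hp.isProb
  have hY : MemLp (fun z : ℝ × ℝ => (z.2 + -(lam * mu / 2 * (kap + 1)) * z.1) / mu) 2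
      (momentumLaw σ) := by
    simp only [div_eq_mul_inv]
    exact (hp.snd.add (hp.fst.const_mul _)).mul_const _
  rw [lawF_eq hσ hψ hmu, covP, covariance_comm, ← variance_add_const_mul_div hp.snd hp.fst]
  exact hasVariance_map_prod hψ.memLp_mom (by fun_prop) hY

theorem mul_neg_iff_of_pos_left' {c x : ℝ} (hc : 0 < c) : c * x < 0 ↔ x < 0 :=
  ⟨fun h => neg_of_mul_neg_right h hc.le, mul_neg_of_pos_of_neg hc⟩

theorem focusDefined (hσ : ∀ i, GaussianDecay (σ.wave i))
    (hq : HasSecondMoments (positionLaw σ)) (hp : HasSecondMoments (momentumLaw σ))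
    (hψ : IsSystemState ψ) {lam mu : ℝ} (hlam : lam ≠ 0) (hmu : mu ≠ 0) (kap : ℝ) :
    FocusDefined lam mu kap σ ψ :=
  ⟨(lawE_variance hσ hq hψ hlam mu kap).1, (lawE_variance hσ hq hψ hlam 0 kap).1,
    (lawF_variance hσ hp hψ hmu lam kap).1, (lawF_variance hσ hp hψ hmu 0 kap).1⟩

/-- The variance of ψ and that of Q₁ occur in both measurements and cancel; this is why the focusing
criterion does not depend on ψ. -/
theorem focusQ_eq (hσ : ∀ i, GaussianDecay (σ.wave i))
    (hq : HasSecondMoments (positionLaw σ)) (hψ : IsSystemState ψ) {lam : ℝ} (hlam : lam ≠ 0)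
    (mu kap : ℝ) :
    focusQ lam mu kap σ ψ = (mu / 2) ^ 2 * (kap - 1) ^ 2 * Var[Prod.snd; positionLaw σ] +
      mu / lam * (kap - 1) * covQ σ := by
  rw [focusQ, (lawE_variance hσ hq hψ hlam mu kap).2, (lawE_variance hσ hq hψ hlam 0 kap).2]
  field_simp
  ring

theorem focusP_eq (hσ : ∀ i, GaussianDecay (σ.wave i))
    (hp : HasSecondMoments (momentumLaw σ)) (hψ : IsSystemState ψ) {mu : ℝ} (hmu : mu ≠ 0)
    (lam kap : ℝ) :
    focusP lam mu kap σ ψ = (lam / 2) ^ 2 * (kap + 1) ^ 2 * Var[Prod.fst; momentumLaw σ] -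
      lam / mu * (kap + 1) * covP σ := by
  rw [focusP, (lawF_variance hσ hp hψ hmu lam kap).2, (lawF_variance hσ hp hψ hmu 0 kap).2]
  field_simp
  ring

/-- Joint focusing in terms of second moments of the probe state. -/
theorem jointFocusing_iff (hσ : ∀ i, GaussianDecay (σ.wave i))
    (hq : HasSecondMoments (positionLaw σ)) (hp : HasSecondMoments (momentumLaw σ))
    (hψ : IsSystemState ψ) {lam mu : ℝ} (hlam : 0 < lam) (hmu : 0 < mu) (kap : ℝ) :
    JointFocusing lam mu kap σ ψ ↔
      (kap - 1) * (lam * mu / 4 * (kap - 1) * Var[Prod.snd; positionLaw σ] + covQ σ) < 0 ∧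
      (kap + 1) * (lam * mu / 4 * (kap + 1) * Var[Prod.fst; momentumLaw σ] - covP σ) < 0 := by
  rw [JointFocusing, focusQ_eq hσ hq hψ hlam.ne', focusP_eq hσ hp hψ hmu.ne']
  have h1 : (mu / 2) ^ 2 * (kap - 1) ^ 2 * Var[Prod.snd; positionLaw σ] +
      mu / lam * (kap - 1) * covQ σ = mu / lam *
      ((kap - 1) * (lam * mu / 4 * (kap - 1) * Var[Prod.snd; positionLaw σ] + covQ σ)) := by
    field_simp
    ring
  have h2 : (lam / 2) ^ 2 * (kap + 1) ^ 2 * Var[Prod.fst; momentumLaw σ] -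
      lam / mu * (kap + 1) * covP σ = lam / mu *
      ((kap + 1) * (lam * mu / 4 * (kap + 1) * Var[Prod.fst; momentumLaw σ] - covP σ)) := by
    field_simp
    ring
  rw [h1, h2, mul_neg_iff_of_pos_left' (div_pos hmu hlam),
    mul_neg_iff_of_pos_left' (div_pos hlam hmu)]

end

end

/-! ### Second moments of the two-mode Gaussian -/

noncomputable section

theorem positionLaw_pure (φ : ℝ × ℝ → ℂ) :
    positionLaw (.pure φ) = volume.withDensity fun z => ‖φ z‖ₑ ^ 2 := by
  change ∑ i : Fin 1, ENNReal.ofReal (![1] i) •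
    volume.withDensity (fun z => ‖(![φ] : Fin 1 → ℝ × ℝ → ℂ) i z‖ₑ ^ 2) = _
  simp

theorem momentumLaw_pure (φ : ℝ × ℝ → ℂ) :
    momentumLaw (.pure φ) = volume.withDensity fun z => ‖fourierTwo φ z‖ₑ ^ 2 := by
  change ∑ i : Fin 1, ENNReal.ofReal (![1] i) •
    volume.withDensity (fun z => ‖fourierTwo ((![φ] : Fin 1 → ℝ × ℝ → ℂ) i) z‖ₑ ^ 2) = _
  simp

theorem fourierOne_gaussian {A : ℂ} (hA : 0 < A.re) (B C : ℂ) (p : ℝ) :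
    fourierOne (fun q => Complex.exp (-A * (q : ℂ) ^ 2 + B * q + C)) p =
      ((Real.sqrt (2 * Real.pi))⁻¹ : ℝ) * (Real.pi / A) ^ (1 / 2 : ℂ) *
        Complex.exp (-(1 / (4 * A)) * (p : ℂ) ^ 2 + -(Complex.I * B / (2 * A)) * p +
          (C + B ^ 2 / (4 * A))) := by
  have hA0 : A ≠ 0 := fun h => by simp [h] at hA
  rw [fourierOne]
  have := integral_cexp_quadratic (b := -A) (by simpa using hA) (B - Complex.I * p) C
  rw [neg_neg] at this
  rw [mul_assoc]
  congr 1
  convert this using 3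
  · rw [← Complex.exp_add]
    congr 1
    push_cast
    ring
  · field_simp
    linear_combination -2 * (p : ℂ) ^ 2 * Complex.I_sq

theorem fourierOne_const_mul (c : ℂ) (f : ℝ → ℂ) (p : ℝ) :
    fourierOne (fun q => c * f q) p = c * fourierOne f p := by
  unfold fourierOne
  rw [mul_left_comm, ← integral_const_mul c]
  congr 2
  ext q
  ring

theorem GaussianDecay.fourierTwo_eq {φ : ℝ × ℝ → ℂ} (hφ : GaussianDecay φ) (p s : ℝ) :
    fourierTwo φ (p, s) = fourierOne (fun r => fourierOne (fun y => φ (r, y)) s) p := by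
  simpa using (hφ.fourierOne_fourierOne_slice 0 s p).symm

section twoMode

theorem twoModeGaussian_apply (a b d x y : ℝ) :
    twoModeGaussian !![a, b; b, d] (x, y) =
      (((4 * (a * d - b * b) / Real.pi ^ 2) ^ (1 / 4 : ℝ) *
        Real.exp (-(a * x ^ 2 + 2 * b * x * y + d * y ^ 2)) : ℝ) : ℂ) := by
  simp only [twoModeGaussian, Matrix.det_fin_two_of]
  congr 3
  simp [Matrix.mulVec, dotProduct, Fin.sum_univ_two]
  ring

variable {a b d : ℝ}

theorem gaussianDecay_twoModeGaussian (ha : 0 < a) (hdet : 0 < a * d - b * b) :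
    GaussianDecay (twoModeGaussian !![a, b; b, d]) where
  continuous := by
    have : twoModeGaussian !![a, b; b, d] = fun z => twoModeGaussian !![a, b; b, d] (z.1, z.2) :=
      rfl
    rw [this]
    simp only [twoModeGaussian_apply]
    fun_prop
  bound := by
    have hd : 0 < d := by
      by_contra! h
      nlinarith [mul_nonneg ha.le (neg_nonneg.2 h), mul_self_nonneg b]
    -- Determinant over trace is a positive lower bound for the smallest eigenvalue of D.
    set e := (a * d - b * b) / (a + d) with he
    have he0 : 0 < e := by positivity
    have hee : e * (a + d) = a * d - b * b := by
      rw [he]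
      field_simp
    refine ⟨(4 * (a * d - b * b) / Real.pi ^ 2) ^ (1 / 4 : ℝ), e, he0, fun x y => ?_⟩
    rw [twoModeGaussian_apply, Complex.norm_real, Real.norm_of_nonneg (by positivity),
      ← Real.exp_add]
    gcongr
    have h1 : 0 < a - e := by
      have : 0 < (a - e) * (a + d) := by nlinarith [mul_self_nonneg b, sq_pos_of_pos ha]
      exact pos_of_mul_pos_left this (by positivity)
    -- Completing the square in the form of D - e; its determinant is e², since e·tr D = det D.
    have h2 : 0 ≤ (a - e) * ((a - e) * x ^ 2 + 2 * b * x * y + (d - e) * y ^ 2) := by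
      have : (a - e) * ((a - e) * x ^ 2 + 2 * b * x * y + (d - e) * y ^ 2) =
          ((a - e) * x + b * y) ^ 2 + e ^ 2 * y ^ 2 := by
        linear_combination (-y ^ 2) * hee
      rw [this]
      positivity
    have h3 := nonneg_of_mul_nonneg_right h2 h1
    linarith

/-- Completing the square, ax² + 2bxy + dy² = a(x + by/a)² + (Δ/a)y² with Δ = ad - b²; hence x +
by/a and y are independent centred Gaussians, and all moments follow from those in one dimension. -/
theorem withDensity_twoModeGaussian (ha : 0 < a) (hdet : 0 < a * d - b * b) :
    (volume.withDensity fun z => ‖twoModeGaussian !![a, b; b, d] z‖ₑ ^ 2) =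
      ((gaussianReal 0 (Real.toNNReal (1 / (4 * a)))).prod
        (gaussianReal 0 (Real.toNNReal (a / (4 * (a * d - b * b)))))).map
        (fun w => (w.1 - b / a * w.2, w.2)) := by
  have hc := (gaussianDecay_twoModeGaussian ha hdet).continuous.measurable
  refine Measure.ext_of_lintegral _ fun f hf => ?_
  have hv1 : Real.toNNReal (1 / (4 * a)) ≠ 0 := by
    rw [Ne, Real.toNNReal_eq_zero, not_le]
    positivity
  have hv2 : Real.toNNReal (a / (4 * (a * d - b * b))) ≠ 0 := by
    rw [Ne, Real.toNNReal_eq_zero, not_le]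
    positivity
  rw [lintegral_map hf (by fun_prop), gaussianReal_of_var_ne_zero _ hv1,
    gaussianReal_of_var_ne_zero _ hv2, prod_withDensity (by fun_prop) (by fun_prop),
    lintegral_withDensity_eq_lintegral_mul _ (by fun_prop) hf,
    lintegral_withDensity_eq_lintegral_mul _ (by fun_prop) (by fun_prop),
    Measure.volume_eq_prod, lintegral_prod_symm _ (by fun_prop),
    lintegral_prod_symm _ (by fun_prop)]
  refine lintegral_congr fun y => ?_
  rw [← lintegral_add_right_eq_self _ (-(b / a * y))]
  refine lintegral_congr fun x => ?_
  simp only [Pi.mul_apply, ← sub_eq_add_neg]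
  congr 1
  rw [twoModeGaussian_apply, gaussianPDF, gaussianPDF,
    ← ENNReal.ofReal_mul (gaussianPDFReal_nonneg _ _ _), ← ofReal_norm,
    ← ENNReal.ofReal_pow (norm_nonneg _), Complex.norm_real,
    Real.norm_of_nonneg (by positivity)]
  congr 1
  rw [gaussianPDFReal, gaussianPDFReal, Real.coe_toNNReal _ (by positivity),
    Real.coe_toNNReal _ (by positivity), mul_pow, ← Real.rpow_natCast, ← Real.rpow_mul
    (by positivity), ← Real.exp_nat_mul, mul_mul_mul_comm, ← Real.exp_add, ← mul_inv,
    ← Real.sqrt_mul (by positivity), ← Real.sqrt_inv, Real.sqrt_eq_rpow]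
  congr 2
  · field_simp
    norm_num
    ring
  · norm_num
  · push_cast
    field_simp
    ring

theorem memLp_id_gaussianReal_two (m : ℝ) (v : NNReal) : MemLp id 2 (gaussianReal m v) :=
  memLp_id_gaussianReal' 2 (by norm_num)

theorem twoModeGaussian_moments (ha : 0 < a) (hdet : 0 < a * d - b * b) :
    let ν := volume.withDensity fun z => ‖twoModeGaussian !![a, b; b, d] z‖ₑ ^ 2
    HasSecondMoments ν ∧ Var[Prod.fst; ν] = d / (4 * (a * d - b * b)) ∧
      Var[Prod.snd; ν] = a / (4 * (a * d - b * b)) ∧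
      cov[Prod.fst, Prod.snd; ν] = -b / (4 * (a * d - b * b)) := by
  intro ν
  simp only [ν, withDensity_twoModeGaussian ha hdet]
  set v1 := Real.toNNReal (1 / (4 * a)) with hv1
  set v2 := Real.toNNReal (a / (4 * (a * d - b * b))) with hv2
  set μ := (gaussianReal 0 v1).prod (gaussianReal 0 v2)
  have hT : Measurable (fun w : ℝ × ℝ => (w.1 - b / a * w.2, w.2)) := by fun_prop
  have h1 : MemLp (fun w : ℝ × ℝ => w.1) 2 μ :=
    (memLp_id_gaussianReal_two 0 v1).comp_measurePreserving measurePreserving_fst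
  have h2 : MemLp (fun w : ℝ × ℝ => w.2) 2 μ :=
    (memLp_id_gaussianReal_two 0 v2).comp_measurePreserving measurePreserving_snd
  have e1 : Var[fun w : ℝ × ℝ => w.1; μ] = v1 := by
    have := variance_map (μ := μ) (X := id) (Y := Prod.fst) measurable_id.aemeasurable
      measurable_fst.aemeasurable
    rw [← Measure.fst, Measure.fst_prod, variance_id_gaussianReal] at this
    exact this.symm
  have e2 : Var[fun w : ℝ × ℝ => w.2; μ] = v2 := by
    have := variance_map (μ := μ) (X := id) (Y := Prod.snd) measurable_id.aemeasurable
      measurable_snd.aemeasurable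
    rw [← Measure.snd, Measure.snd_prod, variance_id_gaussianReal] at this
    exact this.symm
  have e3 : cov[fun w : ℝ × ℝ => w.1, fun w : ℝ × ℝ => w.2; μ] = 0 :=
    covariance_fst_snd_prod (memLp_id_gaussianReal_two 0 v1) (memLp_id_gaussianReal_two 0 v2)
  have e4 : (v1 : ℝ) = 1 / (4 * a) := Real.coe_toNNReal _ (by positivity)
  have e5 : (v2 : ℝ) = a / (4 * (a * d - b * b)) := Real.coe_toNNReal _ (by positivity)
  have h3 : MemLp (fun w : ℝ × ℝ => w.1 - b / a * w.2) 2 μ := h1.sub (h2.const_mul _)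
  have hdet' := hdet.ne'
  refine ⟨⟨Measure.isProbabilityMeasure_map hT.aemeasurable, ?_, ?_⟩, ?_, ?_, ?_⟩
  · rw [memLp_map_measure_iff measurable_fst.aestronglyMeasurable hT.aemeasurable]
    exact h3
  · rw [memLp_map_measure_iff measurable_snd.aestronglyMeasurable hT.aemeasurable]
    exact h2
  · rw [variance_map measurable_fst.aemeasurable hT.aemeasurable]
    change Var[fun w : ℝ × ℝ => w.1 - b / a * w.2; μ] = _
    rw [variance_fun_sub h1 (h2.const_mul _), covariance_const_mul_right, variance_const_mul, e1,
      e2, e3, e4, e5]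
    obtain ⟨Δ, hΔ⟩ : ∃ Δ, Δ = a * d - b * b := ⟨_, rfl⟩
    rw [← hΔ] at hdet' ⊢
    field_simp
    linear_combination hΔ
  · rw [variance_map measurable_snd.aemeasurable hT.aemeasurable, ← e5, ← e2]
    rfl
  · rw [covariance_map measurable_fst.aestronglyMeasurable measurable_snd.aestronglyMeasurable
      hT.aemeasurable]
    change cov[fun w : ℝ × ℝ => w.1 - b / a * w.2, fun w : ℝ × ℝ => w.2; μ] = _
    rw [covariance_fun_sub_left h1 (h2.const_mul _) h2, covariance_const_mul_left, e3,
      covariance_self (by fun_prop), e2, e5]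
    field_simp
    ring

/-- The transform of the Gaussian with matrix D has matrix D⁻¹/4, so the momentum moments are the
position moments of another state of the same family. -/
theorem fourierTwo_twoModeGaussian (ha : 0 < a) (hdet : 0 < a * d - b * b) :
    fourierTwo (twoModeGaussian !![a, b; b, d]) =
      twoModeGaussian !![d / (4 * (a * d - b * b)), -b / (4 * (a * d - b * b));
        -b / (4 * (a * d - b * b)), a / (4 * (a * d - b * b))] := by
  have hd : 0 < d := by
    by_contra! h
    nlinarith [mul_nonneg ha.le (neg_nonneg.2 h), mul_self_nonneg b]
  ext ⟨p, s⟩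
  rw [(gaussianDecay_twoModeGaussian ha hdet).fourierTwo_eq, twoModeGaussian_apply]
  set Δ := a * d - b * b with hΔ
  have hdC : (d : ℂ) ≠ 0 := by exact_mod_cast hd.ne'
  have hΔC : (Δ : ℂ) ≠ 0 := by exact_mod_cast hdet.ne'
  have hΔ' : (Δ : ℂ) = a * d - b * b := by
    rw [hΔ]
    push_cast
    ring
  set K : ℝ := (4 * Δ / Real.pi ^ 2) ^ (1 / 4 : ℝ) with hK
  -- Integrating out y leaves a Gaussian in r whose coefficient is the Schur complement Δ/d.
  have e1 : ∀ r : ℝ, fourierOne (fun y => twoModeGaussian !![a, b; b, d] (r, y)) s =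
      (K * (((Real.sqrt (2 * Real.pi))⁻¹ : ℝ) * (Real.pi / (d : ℂ)) ^ (1 / 2 : ℂ))) *
        Complex.exp (-((Δ / d : ℝ) : ℂ) * (r : ℂ) ^ 2 + (Complex.I * b * s / d) * r +
          (-(s : ℂ) ^ 2 / (4 * d))) := by
    intro r
    have : ∀ y : ℝ, twoModeGaussian !![a, b; b, d] (r, y) = (K : ℂ) *
        Complex.exp (-(d : ℂ) * (y : ℂ) ^ 2 + (-2 * b * r : ℂ) * y + (-a * r ^ 2 : ℂ)) := by
      intro y
      rw [twoModeGaussian_apply, Complex.ofReal_mul, Complex.ofReal_exp]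
      congr 2
      push_cast
      ring
    simp only [this]
    rw [fourierOne_const_mul, fourierOne_gaussian (by simpa using hd), ← mul_assoc]
    congr 2
    push_cast
    rw [hΔ']
    field_simp
    ring
  simp only [e1]
  rw [fourierOne_const_mul, fourierOne_gaussian (by
    rw [Complex.ofReal_re]
    positivity), Complex.ofReal_mul, Complex.ofReal_exp, ← mul_assoc]
  congr 1
  · have c1 : (Real.pi / (d : ℂ)) ^ (1 / 2 : ℂ) = (((Real.pi / d) ^ (1 / 2 : ℝ) : ℝ) : ℂ) := by
      rw [Complex.ofReal_cpow (by positivity)]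
      push_cast
      rfl
    have c2 : (Real.pi / ((Δ / d : ℝ) : ℂ)) ^ (1 / 2 : ℂ) =
        (((Real.pi / (Δ / d)) ^ (1 / 2 : ℝ) : ℝ) : ℂ) := by
      rw [Complex.ofReal_cpow (by positivity)]
      push_cast
      rfl
    rw [c1, c2]
    norm_cast
    have hpi := Real.pi_pos
    -- The product of the two prefactors is 1/(2√Δ), written as a fourth root to merge with `K`;
    -- this matches det(D⁻¹/4) = 1/(16Δ).
    have c3 : (Real.sqrt (2 * Real.pi))⁻¹ * (Real.pi / d) ^ (1 / 2 : ℝ) *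
        ((Real.sqrt (2 * Real.pi))⁻¹ * (Real.pi / (Δ / d)) ^ (1 / 2 : ℝ)) =
        (1 / (16 * Δ ^ 2)) ^ (1 / 4 : ℝ) := by
      rw [← Real.sqrt_eq_rpow, ← Real.sqrt_eq_rpow, ← Real.sqrt_inv, ← Real.sqrt_mul
        (by positivity), ← Real.sqrt_mul (by positivity), ← Real.sqrt_mul (by positivity),
        Real.sqrt_eq_rpow, show (1 / (16 * Δ ^ 2)) = (1 / (4 * Δ)) ^ (2 : ℝ) by
          rw [Real.rpow_ofNat]; ring_nf, ← Real.rpow_mul (by positivity)]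
      norm_num
      congr 1
      field_simp
      norm_num
    trans K * ((Real.sqrt (2 * Real.pi))⁻¹ * (Real.pi / d) ^ (1 / 2 : ℝ) *
      ((Real.sqrt (2 * Real.pi))⁻¹ * (Real.pi / (Δ / d)) ^ (1 / 2 : ℝ)))
    · ring
    rw [c3, hK, ← Real.mul_rpow (by positivity) (by positivity)]
    congr 1
    field_simp
    rw [hΔ]
    ring
  · congr 1
    push_cast
    field_simp
    rw [hΔ']
    ring_nf
    simp only [Complex.I_sq]
    ring

end twoMode

end

/-! ### Single-mode Gaussian states and their products -/

noncomputable section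

namespace IsGaussianWave

variable {f g : ℝ → ℂ}

theorem continuous (hf : IsGaussianWave f) : Continuous f := by
  obtain ⟨⟨A, B, C, hA, h⟩, -⟩ := hf
  rw [show f = _ from funext h]
  fun_prop

theorem lintegral_eq_one (hf : IsGaussianWave f) : ∫⁻ q, ‖f q‖ₑ ^ 2 = 1 :=
  lintegral_enorm_sq_eq_one hf.continuous.aestronglyMeasurable hf.2

theorem isProbabilityMeasure (hf : IsGaussianWave f) : IsProbabilityMeasure (bornLaw f) :=
  isProbabilityMeasure_bornLaw hf.lintegral_eq_one

theorem norm_eq (hf : IsGaussianWave f) :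
    ∃ K a m : ℝ, 0 < a ∧ 0 < K ∧ ∀ q, ‖f q‖ = K * Real.exp (-a * (q - m) ^ 2) := by
  obtain ⟨⟨A, B, C, hA, h⟩, -⟩ := hf
  refine ⟨Real.exp (C.re + B.re ^ 2 / (4 * A.re)), A.re, B.re / (2 * A.re), hA,
    Real.exp_pos _, fun q => ?_⟩
  have e : (-A * (q : ℂ) ^ 2 + B * q + C).re = -A.re * q ^ 2 + B.re * q + C.re := by
    rw [← Complex.ofReal_pow, Complex.add_re, Complex.add_re, Complex.re_mul_ofReal,
      Complex.re_mul_ofReal, Complex.neg_re]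
  rw [h, Complex.norm_exp, e, ← Real.exp_add]
  congr 1
  field_simp
  ring

/-- By `norm_eq`, |f|² is a constant multiple of a Gaussian density; both measures have mass one, so
the constant is 1 and need not be computed. -/
theorem exists_gaussianReal (hf : IsGaussianWave f) :
    ∃ (m : ℝ) (v : NNReal), bornLaw f = gaussianReal m v := by
  obtain ⟨K, a, m, ha, hK, h⟩ := hf.norm_eq
  set v := Real.toNNReal (1 / (4 * a)) with hv
  have hv' : (v : ℝ) = 1 / (4 * a) := Real.coe_toNNReal _ (by positivity)
  have hv0 : v ≠ 0 := by
    rw [Ne, hv, Real.toNNReal_eq_zero, not_le]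
    positivity
  set c := K ^ 2 * Real.sqrt (2 * Real.pi * v) with hc
  have e : bornLaw f = ENNReal.ofReal c • gaussianReal m v := by
    rw [bornLaw, gaussianReal_of_var_ne_zero _ hv0, ← withDensity_smul _ (by fun_prop)]
    congr 1
    ext q
    rw [Pi.smul_apply, smul_eq_mul, gaussianPDF, ← ENNReal.ofReal_mul (by positivity),
      ← ofReal_norm, ← ENNReal.ofReal_pow (norm_nonneg _), h]
    congr 1
    have hs : Real.sqrt (2 * Real.pi * v) ≠ 0 := by
      rw [hv']
      positivity
    rw [gaussianPDFReal, hc, ← mul_assoc, mul_assoc (K ^ 2), mul_inv_cancel₀ hs, mul_one, mul_pow,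
      ← Real.exp_nat_mul, hv']
    congr 2
    push_cast
    field_simp
    ring
  have := hf.isProbabilityMeasure
  have h1 : bornLaw f Set.univ = 1 := measure_univ
  rw [e, Measure.smul_apply, measure_univ, smul_eq_mul, mul_one] at h1
  rw [h1, one_smul] at e
  exact ⟨m, v, e⟩

theorem memLp_id (hf : IsGaussianWave f) : MemLp id 2 (bornLaw f) := by
  obtain ⟨m, v, h⟩ := hf.exists_gaussianReal
  rw [h]
  exact memLp_id_gaussianReal_two m v

/-- The bound is given for every smaller rate so that two factors can share one rate in
`gaussianDecay_mul`. -/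
theorem norm_le (hf : IsGaussianWave f) :
    ∃ K ε : ℝ, 0 < ε ∧ ∀ ε', 0 < ε' → ε' ≤ ε → ∀ q, ‖f q‖ ≤ K * Real.exp (-ε' * q ^ 2) := by
  obtain ⟨K, a, m, ha, hK, h⟩ := hf.norm_eq
  refine ⟨K * Real.exp (a * m ^ 2), a / 2, by positivity, fun ε' h0 h1 q => ?_⟩
  rw [h, mul_assoc, ← Real.exp_add]
  gcongr
  nlinarith [mul_nonneg ha.le (sq_nonneg (q - 2 * m)), mul_nonneg (sub_nonneg.2 h1) (sq_nonneg q)]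

theorem integrable (hf : IsGaussianWave f) : Integrable f := by
  obtain ⟨K, ε, hε, h⟩ := hf.norm_le
  exact ((integrable_exp_neg_mul_sq hε).const_mul K).mono' hf.continuous.aestronglyMeasurable
    (ae_of_all _ (h ε hε le_rfl))

theorem memLp_two (hf : IsGaussianWave f) : MemLp f 2 := by
  obtain ⟨K, a, m, ha, hK, h⟩ := hf.norm_eq
  refine memLp_two_of_bounded hf.integrable (C := K) fun q => ?_
  rw [h]
  refine mul_le_of_le_one_right hK.le ?_
  rw [Real.exp_le_one_iff]
  nlinarith [mul_nonneg ha.le (sq_nonneg (q - m))]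

theorem fourier (hf : IsGaussianWave f) : IsGaussianWave (fourierOne f) := by
  refine ⟨?_, ?_⟩
  · obtain ⟨⟨A, B, C, hA, h⟩, -⟩ := hf
    have hA0 : A ≠ 0 := fun h => by simp [h] at hA
    have hk : ((Real.sqrt (2 * Real.pi))⁻¹ : ℝ) * (Real.pi / A) ^ (1 / 2 : ℂ) ≠ (0 : ℂ) := by
      refine mul_ne_zero ?_ ?_
      · rw [Complex.ofReal_ne_zero]
        positivity
      · rw [Complex.cpow_ne_zero_iff]
        left
        exact div_ne_zero (by exact_mod_cast Real.pi_ne_zero) hA0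
    -- The nonzero prefactor of the transform is absorbed into the constant term of the exponent
    -- through its logarithm.
    refine ⟨1 / (4 * A), -(Complex.I * B / (2 * A)), Complex.log
      (((Real.sqrt (2 * Real.pi))⁻¹ : ℝ) * (Real.pi / A) ^ (1 / 2 : ℂ)) + (C + B ^ 2 / (4 * A)),
      ?_, fun p => ?_⟩
    · have : (1 / (4 * A)) = ((1 / 4 : ℝ) : ℂ) * A⁻¹ := by
        push_cast
        field_simp
      rw [this, Complex.re_ofReal_mul, Complex.inv_re]
      have := Complex.normSq_pos.2 hA0
      positivity
    · rw [show f = _ from funext h, fourierOne_gaussian hA]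
      nth_rewrite 1 [← Complex.exp_log hk]
      rw [← Complex.exp_add]
      congr 1
      ring
  · have := continuous_fourierOne hf.integrable
    rw [integral_eq_lintegral_of_nonneg_ae (ae_of_all _ fun q => by positivity)
      (by fun_prop : Continuous _).aestronglyMeasurable]
    have : ∀ p, ENNReal.ofReal (‖fourierOne f p‖ ^ 2) = ‖fourierOne f p‖ₑ ^ 2 := fun p => by
      rw [ENNReal.ofReal_pow (norm_nonneg _), ofReal_norm]
    simp only [this]
    rw [lintegral_enorm_sq_fourierOne hf.integrable hf.memLp_two, hf.lintegral_eq_one,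
      ENNReal.toReal_one]

theorem gaussianDecay_mul (hf : IsGaussianWave f) (hg : IsGaussianWave g) :
    GaussianDecay fun z => f z.1 * g z.2 where
  continuous := by
    have := hf.continuous
    have := hg.continuous
    fun_prop
  bound := by
    obtain ⟨K, ε, hε, h⟩ := hf.norm_le
    obtain ⟨K', ε', hε', h'⟩ := hg.norm_le
    refine ⟨K * K', min ε ε', lt_min hε hε', fun x y => ?_⟩
    rw [norm_mul]
    refine (mul_le_mul (h _ (lt_min hε hε') (min_le_left _ _) x)
      (h' _ (lt_min hε hε') (min_le_right _ _) y) (norm_nonneg _)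
      ((norm_nonneg _).trans (h _ (lt_min hε hε') (min_le_left _ _) x))).trans_eq ?_
    ring

theorem withDensity_mul (hf : IsGaussianWave f) (hg : IsGaussianWave g) :
    (volume.withDensity fun z : ℝ × ℝ => ‖f z.1 * g z.2‖ₑ ^ 2) =
      (bornLaw f).prod (bornLaw g) := by
  have hfm := hf.continuous.measurable
  have hgm := hg.continuous.measurable
  rw [bornLaw, bornLaw, prod_withDensity (by fun_prop) (by fun_prop), Measure.volume_eq_prod]
  simp only [enorm_mul, mul_pow]

theorem hasSecondMoments_prod (hf : IsGaussianWave f) (hg : IsGaussianWave g) :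
    HasSecondMoments ((bornLaw f).prod (bornLaw g)) := by
  have := hf.isProbabilityMeasure
  have := hg.isProbabilityMeasure
  exact ⟨inferInstance, hf.memLp_id.comp_measurePreserving measurePreserving_fst,
    hg.memLp_id.comp_measurePreserving measurePreserving_snd⟩

theorem covariance_prod (hf : IsGaussianWave f) (hg : IsGaussianWave g) :
    cov[Prod.fst, Prod.snd; (bornLaw f).prod (bornLaw g)] = 0 := by
  have := hf.isProbabilityMeasure
  have := hg.isProbabilityMeasure
  exact covariance_fst_snd_prod hf.memLp_id hg.memLp_id

theorem fourierTwo_mul (hf : IsGaussianWave f) (hg : IsGaussianWave g) :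
    fourierTwo (fun z => f z.1 * g z.2) = fun z => fourierOne f z.1 * fourierOne g z.2 := by
  ext ⟨p, s⟩
  rw [(hf.gaussianDecay_mul hg).fourierTwo_eq]
  simp only [fourierOne_const_mul]
  simp only [mul_comm (f _)]
  rw [fourierOne_const_mul, mul_comm]

end IsGaussianWave

namespace IsGaussianProduct

variable {x k S R : ℝ} {φ : ℝ × ℝ → ℂ}

theorem gaussianDecay (h : IsGaussianProduct x k S R φ) : GaussianDecay φ := by
  obtain ⟨f, g, hf, hg, e⟩ := h.product
  rw [show φ = _ from funext e]
  exact hf.gaussianDecay_mul hg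

theorem position (h : IsGaussianProduct x k S R φ) :
    HasSecondMoments (positionLaw (.pure φ)) ∧ covQ (.pure φ) = 0 := by
  obtain ⟨f, g, hf, hg, e⟩ := h.product
  rw [covQ, positionLaw_pure, show φ = _ from funext e, hf.withDensity_mul hg]
  exact ⟨hf.hasSecondMoments_prod hg, hf.covariance_prod hg⟩

theorem momentum (h : IsGaussianProduct x k S R φ) :
    HasSecondMoments (momentumLaw (.pure φ)) ∧ covP (.pure φ) = 0 := by
  obtain ⟨f, g, hf, hg, e⟩ := h.product
  rw [covP, momentumLaw_pure, show φ = _ from funext e, hf.fourierTwo_mul hg,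
    hf.fourier.withDensity_mul hg.fourier]
  exact ⟨hf.fourier.hasSecondMoments_prod hg.fourier, hf.fourier.covariance_prod hg.fourier⟩

theorem S_nonneg (h : IsGaussianProduct x k S R φ) : 0 ≤ S := h.var_Q₁ ▸ variance_nonneg _ _

theorem R_nonneg (h : IsGaussianProduct x k S R φ) : 0 ≤ R := h.var_P₁ ▸ variance_nonneg _ _

end IsGaussianProduct

/-! ### Mixtures and the law of total covariance -/

section mixture

variable {ν₁ ν₂ : Measure (ℝ × ℝ)} {p : ℝ}

/-- The convex combination `p ν₁ + (1 - p) ν₂`. -/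
def mixture (p : ℝ) (ν₁ ν₂ : Measure (ℝ × ℝ)) : Measure (ℝ × ℝ) :=
  ENNReal.ofReal p • ν₁ + ENNReal.ofReal (1 - p) • ν₂

theorem positionLaw_mix (p : ℝ) (φ₁ φ₂ : ℝ × ℝ → ℂ) : positionLaw (.mix p φ₁ φ₂) =
    mixture p (positionLaw (.pure φ₁)) (positionLaw (.pure φ₂)) := by
  rw [mixture, positionLaw_pure, positionLaw_pure]
  exact Fin.sum_univ_two (fun i : Fin 2 => ENNReal.ofReal (![p, 1 - p] i) •
    (volume : Measure (ℝ × ℝ)).withDensity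
      (fun z => ‖(![φ₁, φ₂] : Fin 2 → ℝ × ℝ → ℂ) i z‖ₑ ^ 2))

theorem momentumLaw_mix (p : ℝ) (φ₁ φ₂ : ℝ × ℝ → ℂ) : momentumLaw (.mix p φ₁ φ₂) =
    mixture p (momentumLaw (.pure φ₁)) (momentumLaw (.pure φ₂)) := by
  rw [mixture, momentumLaw_pure, momentumLaw_pure]
  exact Fin.sum_univ_two (fun i : Fin 2 => ENNReal.ofReal (![p, 1 - p] i) •
    (volume : Measure (ℝ × ℝ)).withDensity
      (fun z => ‖fourierTwo ((![φ₁, φ₂] : Fin 2 → ℝ × ℝ → ℂ) i) z‖ₑ ^ 2))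

theorem memLp_mixture {X : ℝ × ℝ → ℝ} (h₁ : MemLp X 2 ν₁) (h₂ : MemLp X 2 ν₂) :
    MemLp X 2 (mixture p ν₁ ν₂) := by
  have h₁' : MemLp X 2 (ENNReal.ofReal p • ν₁) := h₁.smul_measure ENNReal.ofReal_ne_top
  have h₂' : MemLp X 2 (ENNReal.ofReal (1 - p) • ν₂) := h₂.smul_measure ENNReal.ofReal_ne_top
  have hm : AEStronglyMeasurable X (mixture p ν₁ ν₂) := h₁'.1.add_measure h₂'.1
  rw [memLp_two_iff_integrable_sq hm]
  exact h₁'.integrable_sq.add_measure h₂'.integrable_sq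

theorem integral_mixture (hp : 0 ≤ p) (hp1 : p ≤ 1) {X : ℝ × ℝ → ℝ} (h₁ : Integrable X ν₁)
    (h₂ : Integrable X ν₂) :
    ∫ z, X z ∂mixture p ν₁ ν₂ = p * ∫ z, X z ∂ν₁ + (1 - p) * ∫ z, X z ∂ν₂ := by
  rw [mixture, integral_add_measure (h₁.smul_measure ENNReal.ofReal_ne_top)
    (h₂.smul_measure ENNReal.ofReal_ne_top), integral_smul_measure, integral_smul_measure,
    ENNReal.toReal_ofReal hp, ENNReal.toReal_ofReal (sub_nonneg.2 hp1), smul_eq_mul, smul_eq_mul]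

theorem hasSecondMoments_mixture (hp : 0 ≤ p) (hp1 : p ≤ 1) (h₁ : HasSecondMoments ν₁)
    (h₂ : HasSecondMoments ν₂) : HasSecondMoments (mixture p ν₁ ν₂) := by
  have := h₁.isProb
  have := h₂.isProb
  refine ⟨⟨?_⟩, memLp_mixture h₁.fst h₂.fst, memLp_mixture h₁.snd h₂.snd⟩
  rw [mixture, Measure.add_apply, Measure.smul_apply, Measure.smul_apply, measure_univ,
    measure_univ, smul_eq_mul, smul_eq_mul, mul_one, mul_one,
    ← ENNReal.ofReal_add hp (sub_nonneg.2 hp1), add_sub_cancel, ENNReal.ofReal_one]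

/-- The mean of the covariances plus the covariance of the means. Taking `X = Y` gives the variances
as well. -/
theorem covariance_mixture (hp : 0 ≤ p) (hp1 : p ≤ 1) (h₁ : HasSecondMoments ν₁)
    (h₂ : HasSecondMoments ν₂) {X Y : ℝ × ℝ → ℝ} (hX₁ : MemLp X 2 ν₁) (hX₂ : MemLp X 2 ν₂)
    (hY₁ : MemLp Y 2 ν₁) (hY₂ : MemLp Y 2 ν₂) :
    cov[X, Y; mixture p ν₁ ν₂] = p * cov[X, Y; ν₁] + (1 - p) * cov[X, Y; ν₂] +
      (p - p ^ 2) * ((∫ z, X z ∂ν₁) - ∫ z, X z ∂ν₂) * ((∫ z, Y z ∂ν₁) - ∫ z, Y z ∂ν₂) := by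
  have := h₁.isProb
  have := h₂.isProb
  have := (hasSecondMoments_mixture hp hp1 h₁ h₂).isProb
  rw [covariance_eq_sub (memLp_mixture hX₁ hX₂) (memLp_mixture hY₁ hY₂),
    covariance_eq_sub hX₁ hY₁, covariance_eq_sub hX₂ hY₂,
    integral_mixture hp hp1 (hX₁.integrable (by norm_num)) (hX₂.integrable (by norm_num)),
    integral_mixture hp hp1 (hY₁.integrable (by norm_num)) (hY₂.integrable (by norm_num)),
    integral_mixture hp hp1 (hX₁.integrable_mul hY₁) (hX₂.integrable_mul hY₂)]
  ring

end mixture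

section

variable {p x₁ k₁ x₂ k₂ S R : ℝ} {φ₁ φ₂ : ℝ × ℝ → ℂ}

theorem gaussianDecay_mix (h₁ : IsGaussianProduct x₁ k₁ S R φ₁)
    (h₂ : IsGaussianProduct x₂ k₂ S R φ₂) (i : Fin (ProbeEnsemble.mix p φ₁ φ₂).size) :
    GaussianDecay ((ProbeEnsemble.mix p φ₁ φ₂).wave i) := by
  change Fin 2 at i
  fin_cases i
  · exact h₁.gaussianDecay
  · exact h₂.gaussianDecay

/-- Each component has the same mean for both probes, so the spread of the means contributes equally
to Var Q₂ and to Cov(Q₁,Q₂), while a product component has covariance zero. -/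
theorem position_mix (hp : 0 ≤ p) (hp1 : p ≤ 1) (h₁ : IsGaussianProduct x₁ k₁ S R φ₁)
    (h₂ : IsGaussianProduct x₂ k₂ S R φ₂) :
    HasSecondMoments (positionLaw (.mix p φ₁ φ₂)) ∧
      covQ (.mix p φ₁ φ₂) = (p - p ^ 2) * (x₁ - x₂) ^ 2 ∧
      Var[Prod.snd; positionLaw (.mix p φ₁ φ₂)] = S + covQ (.mix p φ₁ φ₂) := by
  have e₁ := h₁.position
  have e₂ := h₂.position
  have hc : covQ (.mix p φ₁ φ₂) = (p - p ^ 2) * (x₁ - x₂) ^ 2 := by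
    have e₁' := e₁.2
    have e₂' := e₂.2
    rw [covQ] at e₁' e₂' ⊢
    rw [positionLaw_mix, covariance_mixture hp hp1 e₁.1 e₂.1 e₁.1.fst e₂.1.fst e₁.1.snd e₂.1.snd,
      e₁', e₂', h₁.mean_Q₁, h₁.mean_Q₂, h₂.mean_Q₁, h₂.mean_Q₂]
    ring
  refine ⟨?_, hc, ?_⟩
  · rw [positionLaw_mix]
    exact hasSecondMoments_mixture hp hp1 e₁.1 e₂.1
  · rw [hc, positionLaw_mix, ← covariance_self measurable_snd.aemeasurable,
      covariance_mixture hp hp1 e₁.1 e₂.1 e₁.1.snd e₂.1.snd e₁.1.snd e₂.1.snd,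
      covariance_self measurable_snd.aemeasurable, covariance_self measurable_snd.aemeasurable,
      h₁.var_Q₂, h₂.var_Q₂, h₁.mean_Q₂, h₂.mean_Q₂]
    ring

theorem momentum_mix (hp : 0 ≤ p) (hp1 : p ≤ 1) (h₁ : IsGaussianProduct x₁ k₁ S R φ₁)
    (h₂ : IsGaussianProduct x₂ k₂ S R φ₂) :
    HasSecondMoments (momentumLaw (.mix p φ₁ φ₂)) ∧
      covP (.mix p φ₁ φ₂) = (p - p ^ 2) * (k₁ - k₂) ^ 2 ∧
      Var[Prod.fst; momentumLaw (.mix p φ₁ φ₂)] = R + covP (.mix p φ₁ φ₂) := by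
  have e₁ := h₁.momentum
  have e₂ := h₂.momentum
  have hc : covP (.mix p φ₁ φ₂) = (p - p ^ 2) * (k₁ - k₂) ^ 2 := by
    have e₁' := e₁.2
    have e₂' := e₂.2
    rw [covP] at e₁' e₂' ⊢
    rw [momentumLaw_mix, covariance_mixture hp hp1 e₁.1 e₂.1 e₁.1.fst e₂.1.fst e₁.1.snd e₂.1.snd,
      e₁', e₂', h₁.mean_P₁, h₁.mean_P₂, h₂.mean_P₁, h₂.mean_P₂]
    ring
  refine ⟨?_, hc, ?_⟩
  · rw [momentumLaw_mix]
    exact hasSecondMoments_mixture hp hp1 e₁.1 e₂.1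
  · rw [hc, momentumLaw_mix, ← covariance_self measurable_fst.aemeasurable,
      covariance_mixture hp hp1 e₁.1 e₂.1 e₁.1.fst e₂.1.fst e₁.1.fst e₂.1.fst,
      covariance_self measurable_fst.aemeasurable, covariance_self measurable_fst.aemeasurable,
      h₁.var_P₁, h₂.var_P₁, h₁.mean_P₁, h₂.mean_P₁]
    ring

end

end

/-! ### The focusing inequalities for the two families of probe states -/

theorem gaussian_focusing_iff {t a b k : ℝ} (ht : 0 < t) (ha : 0 < a) :
    ((k - 1) * (t * (k - 1) * a - b) < 0 ∧ (k + 1) * (t * (k + 1) * a - b) < 0) ↔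
      1 < |k| ∧ 0 < k * b ∧ t * (1 + |k|) < |b| / a := by
  rw [lt_div_iff₀ ha]
  have hta : 0 < t * a := by positivity
  constructor
  · rintro ⟨h1, h2⟩
    rcases lt_or_ge 1 k with hk | hk
    · have h3 := (mul_neg_iff_of_pos_left' (sub_pos.2 hk)).1 h1
      have h4 := (mul_neg_iff_of_pos_left' (by linarith : 0 < k + 1)).1 h2
      have hb : 0 < b := by nlinarith
      rw [abs_of_pos (by linarith : 0 < k), abs_of_pos hb]
      exact ⟨hk, by positivity, by nlinarith⟩
    rcases lt_or_ge k (-1) with hk' | hk'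
    · have h3 : 0 < t * (k - 1) * a - b := by
        by_contra! h
        nlinarith [mul_nonneg_of_nonpos_of_nonpos (by linarith : k - 1 ≤ 0) h]
      have h4 : 0 < t * (k + 1) * a - b := by
        by_contra! h
        nlinarith [mul_nonneg_of_nonpos_of_nonpos (by linarith : k + 1 ≤ 0) h]
      have hb : b < 0 := by nlinarith
      rw [abs_of_neg (by linarith : k < 0), abs_of_neg hb]
      exact ⟨by linarith, mul_pos_of_neg_of_neg (by linarith) hb, by nlinarith⟩
    -- For |k| ≤ 1 the two inequalities require b < 0 and b > 0 respectively.
    · exfalso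
      rcases le_total 0 b with hb | hb
      · nlinarith [mul_nonneg hta.le (sq_nonneg (k - 1)), mul_nonneg hb (sub_nonneg.2 hk)]
      · nlinarith [mul_nonneg hta.le (sq_nonneg (k + 1)),
          mul_nonneg (neg_nonneg.2 hb) (by linarith : 0 ≤ k + 1)]
  · rintro ⟨h1, h2, h3⟩
    rcases lt_or_ge 0 k with hk | hk
    · have hb : 0 < b := pos_of_mul_pos_right h2 hk.le
      rw [abs_of_pos hk] at h1 h3
      rw [abs_of_pos hb] at h3
      exact ⟨mul_neg_of_pos_of_neg (by linarith) (by nlinarith),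
        mul_neg_of_pos_of_neg (by linarith) (by nlinarith)⟩
    · have hb : b < 0 := by
        by_contra! hb
        nlinarith [mul_nonneg (neg_nonneg.2 hk) hb]
      rw [abs_of_nonpos hk] at h1 h3
      rw [abs_of_neg hb] at h3
      exact ⟨mul_neg_of_neg_of_pos (by linarith) (by nlinarith),
        mul_neg_of_neg_of_pos (by linarith) (by nlinarith)⟩

variable {lam mu kap : ℝ}

theorem twoMode_focusing (hlam : 0 < lam) (hmu : 0 < mu) {a b d : ℝ} (ha : 0 < a)
    (hdet : 0 < a * d - b * b) {ψ : ℝ → ℂ} (hψ : IsSystemState ψ) :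
    FocusDefined lam mu kap (.pure (twoModeGaussian !![a, b; b, d])) ψ ∧
      (JointFocusing lam mu kap (.pure (twoModeGaussian !![a, b; b, d])) ψ ↔
        1 < |kap| ∧ 0 < kap * b ∧ lam * mu / 4 * (1 + |kap|) < |b| / a) := by
  have hσ : ∀ i, GaussianDecay
      ((ProbeEnsemble.pure (twoModeGaussian !![a, b; b, d])).wave i) := by
    intro i
    change Fin 1 at i
    fin_cases i
    exact gaussianDecay_twoModeGaussian ha hdet
  obtain ⟨hq, -, hqv, hqc⟩ := twoModeGaussian_moments ha hdet
  have hd : 0 < d := by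
    by_contra! h
    nlinarith [mul_nonneg ha.le (neg_nonneg.2 h), mul_self_nonneg b]
  have hdet' : d / (4 * (a * d - b * b)) * (a / (4 * (a * d - b * b))) -
      -b / (4 * (a * d - b * b)) * (-b / (4 * (a * d - b * b))) =
      1 / (16 * (a * d - b * b)) := by
    obtain ⟨Δ, hΔ⟩ : ∃ Δ, Δ = a * d - b * b := ⟨_, rfl⟩
    rw [← hΔ] at hdet ⊢
    field_simp
    linear_combination (-16) * hΔ
  -- Momentum moments: the position computation applied to the matrix D⁻¹/4.
  have hp := twoModeGaussian_moments (a := d / (4 * (a * d - b * b)))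
    (b := -b / (4 * (a * d - b * b))) (d := a / (4 * (a * d - b * b))) (by positivity)
    (by rw [hdet']; positivity)
  rw [← fourierTwo_twoModeGaussian ha hdet, hdet'] at hp
  obtain ⟨hp, hpv, -, hpc⟩ := hp
  rw [← positionLaw_pure] at hq hqv hqc
  rw [← momentumLaw_pure] at hp hpv hpc
  refine ⟨focusDefined hσ hq hp hψ hlam.ne' hmu.ne' kap, ?_⟩
  rw [jointFocusing_iff hσ hq hp hψ hlam hmu, covQ, covP, hqv, hqc, hpv, hpc,
    ← gaussian_focusing_iff (by positivity) ha]
  set Δ := a * d - b * b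
  have e1 : (kap - 1) * (lam * mu / 4 * (kap - 1) * (a / (4 * Δ)) + -b / (4 * Δ)) =
      (4 * Δ)⁻¹ * ((kap - 1) * (lam * mu / 4 * (kap - 1) * a - b)) := by
    ring
  have e2 : a / (4 * Δ) / (4 * (1 / (16 * Δ))) = a := by
    field_simp
    norm_num
  have e3 : -(-b / (4 * Δ)) / (4 * (1 / (16 * Δ))) = b := by
    field_simp
    norm_num
  rw [e1, e2, e3, mul_neg_iff_of_pos_left' (by positivity)]

/-- With nonnegative covariances the first product is nonnegative for k ≥ 1, and the second for k ≤
-1. -/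
theorem abs_lt_one_of_mixture_focusing {t S R C C' k : ℝ} (ht : 0 < t) (hS : 0 ≤ S)
    (hR : 0 ≤ R) (hC : 0 ≤ C) (hC' : 0 ≤ C')
    (h1 : (k - 1) * (t * (k - 1) * (S + C) + C) < 0)
    (h2 : (k + 1) * (t * (k + 1) * (R + C') - C') < 0) : |k| < 1 := by
  rw [abs_lt]
  constructor
  · by_contra! h
    have h3 : 0 ≤ -(k + 1) := by linarith
    have h4 : 0 ≤ t * -(k + 1) * (R + C') := by positivity
    nlinarith [mul_nonneg h3 (add_nonneg h4 hC')]
  · by_contra! h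
    have h3 : 0 ≤ k - 1 := by linarith
    have : 0 ≤ (k - 1) * (t * (k - 1) * (S + C) + C) := by positivity
    linarith

/-- Put r = t(1 + |k|) < 1. Both inequalities reduce to r(V + W) < W, with V the component variance
and W the covariance, that is rV < (1 - r)W. The threshold makes the right side at least S + R + 1,
which exceeds V; the 1 gives strictness even for S = R = 0. -/
theorem mixture_focusing_of_le {t S R C C' k : ℝ} (ht : 0 < t) (hS : 0 ≤ S) (hR : 0 ≤ R)
    (hk : |k| < 1) (hr : t * (1 + |k|) < 1)
    (hC : (S + R + 1) / (1 - t * (1 + |k|)) ≤ C) (hC' : (S + R + 1) / (1 - t * (1 + |k|)) ≤ C') :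
    (k - 1) * (t * (k - 1) * (S + C) + C) < 0 ∧
      (k + 1) * (t * (k + 1) * (R + C') - C') < 0 := by
  have h0 : 0 < 1 - t * (1 + |k|) := by linarith
  have hpos : 0 < (S + R + 1) / (1 - t * (1 + |k|)) := by positivity
  rw [div_le_iff₀ h0] at hC hC'
  have hk1 := abs_lt.1 hk
  have key : ∀ u V W, u ≤ 1 + |k| → 0 ≤ V → V ≤ S + R → 0 < W →
      S + R + 1 ≤ W * (1 - t * (1 + |k|)) → t * u * (V + W) < W := by
    intro u V W hu hV hV' hW h
    have h1 : t * u * (V + W) ≤ t * (1 + |k|) * (V + W) := by gcongr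
    nlinarith
  have hC0 : 0 < C := pos_of_mul_pos_left (by nlinarith : 0 < C * (1 - t * (1 + |k|))) h0.le
  have hC0' : 0 < C' :=
    pos_of_mul_pos_left (by nlinarith : 0 < C' * (1 - t * (1 + |k|))) h0.le
  have a1 := key (1 - k) S C (by linarith [neg_abs_le k]) hS (by linarith) hC0 hC
  have a2 := key (1 + k) R C' (by linarith [le_abs_self k]) hR (by linarith) hC0' hC'
  exact ⟨mul_neg_of_neg_of_pos (by linarith) (by nlinarith),
    mul_neg_of_pos_of_neg (by linarith) (by nlinarith)⟩

theorem jointFocusing_mix_iff (hlam : 0 < lam) (hmu : 0 < mu) {p x₁ k₁ x₂ k₂ S R : ℝ}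
    (hp : 0 < p) (hp1 : p < 1) {φ₁ φ₂ : ℝ × ℝ → ℂ} (h₁ : IsGaussianProduct x₁ k₁ S R φ₁)
    (h₂ : IsGaussianProduct x₂ k₂ S R φ₂) {ψ : ℝ → ℂ} (hψ : IsSystemState ψ) :
    JointFocusing lam mu kap (.mix p φ₁ φ₂) ψ ↔
      (kap - 1) * (lam * mu / 4 * (kap - 1) * (S + covQ (.mix p φ₁ φ₂)) +
        covQ (.mix p φ₁ φ₂)) < 0 ∧
      (kap + 1) * (lam * mu / 4 * (kap + 1) * (R + covP (.mix p φ₁ φ₂)) -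
        covP (.mix p φ₁ φ₂)) < 0 := by
  obtain ⟨q1, -, q3⟩ := position_mix hp.le hp1.le h₁ h₂
  obtain ⟨r1, -, r3⟩ := momentum_mix hp.le hp1.le h₁ h₂
  rw [jointFocusing_iff (gaussianDecay_mix h₁ h₂) q1 r1 hψ hlam hmu, q3, r3]

end ArthursKelly

/-! ### The main theorem -/

open ArthursKelly in
theorem mainTheorem4 (lam mu kap : ℝ) (hlam : 0 < lam) (hmu : 0 < mu) :
    -- two-mode Gaussian state
    (∀ a b d : ℝ, (!![a, b; b, d] : Matrix (Fin 2) (Fin 2) ℝ).PosDef →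
      ∀ ψ : ℝ → ℂ, IsSystemState ψ →
        FocusDefined lam mu kap (.pure (twoModeGaussian !![a, b; b, d])) ψ ∧
        (JointFocusing lam mu kap (.pure (twoModeGaussian !![a, b; b, d])) ψ ↔
          1 < |kap| ∧ 0 < kap * b ∧ lam * mu / 4 * (1 + |kap|) < |b| / a) ∧
        ((JointFocusing lam mu kap (.pure (twoModeGaussian !![a, b; b, d])) ψ ∨
            JointFocusing lam mu kap (.pure (twoModeGaussian !![a, -b; -b, d])) ψ) ↔
          1 < |kap| ∧ lam * mu / 4 * (1 + |kap|) < |b| / a)) ∧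
    -- separable mixture: covariances, and necessity of `|κ| < 1`
    (∀ p x₁ k₁ x₂ k₂ S R : ℝ, 0 < p → p < 1 → ∀ φ₁ φ₂ : ℝ × ℝ → ℂ,
      IsGaussianProduct x₁ k₁ S R φ₁ → IsGaussianProduct x₂ k₂ S R φ₂ →
        covQ (.mix p φ₁ φ₂) = (p - p ^ 2) * (x₁ - x₂) ^ 2 ∧
        covP (.mix p φ₁ φ₂) = (p - p ^ 2) * (k₁ - k₂) ^ 2 ∧
        ∀ ψ : ℝ → ℂ, IsSystemState ψ →
          FocusDefined lam mu kap (.mix p φ₁ φ₂) ψ ∧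
          (JointFocusing lam mu kap (.mix p φ₁ φ₂) ψ → |kap| < 1)) ∧
    -- separable mixture: joint focusing at large covariances
    (|kap| < 1 → lam * mu / 4 * (1 + |kap|) < 1 → ∀ S R : ℝ, ∃ C : ℝ,
      ∀ p x₁ k₁ x₂ k₂ : ℝ, 0 < p → p < 1 → ∀ φ₁ φ₂ : ℝ × ℝ → ℂ,
        IsGaussianProduct x₁ k₁ S R φ₁ → IsGaussianProduct x₂ k₂ S R φ₂ →
          C ≤ covQ (.mix p φ₁ φ₂) → C ≤ covP (.mix p φ₁ φ₂) →
            ∀ ψ : ℝ → ℂ, IsSystemState ψ → JointFocusing lam mu kap (.mix p φ₁ φ₂) ψ) ∧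
    -- separable mixture: joint focusing at large separation in phase space
    (|kap| < 1 → lam * mu / 4 * (1 + |kap|) < 1 → ∀ S R p : ℝ, 0 < p → p < 1 → ∃ L : ℝ,
      ∀ x₁ k₁ x₂ k₂ : ℝ, ∀ φ₁ φ₂ : ℝ × ℝ → ℂ,
        IsGaussianProduct x₁ k₁ S R φ₁ → IsGaussianProduct x₂ k₂ S R φ₂ →
          L ≤ |x₁ - x₂| → L ≤ |k₁ - k₂| →
            ∀ ψ : ℝ → ℂ, IsSystemState ψ → JointFocusing lam mu kap (.mix p φ₁ φ₂) ψ) := by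
  have ht : 0 < lam * mu / 4 := by positivity
  have hlarge : |kap| < 1 → lam * mu / 4 * (1 + |kap|) < 1 → ∀ p x₁ k₁ x₂ k₂ S R : ℝ,
      0 < p → p < 1 → ∀ φ₁ φ₂ : ℝ × ℝ → ℂ,
      IsGaussianProduct x₁ k₁ S R φ₁ → IsGaussianProduct x₂ k₂ S R φ₂ →
      (S + R + 1) / (1 - lam * mu / 4 * (1 + |kap|)) ≤ covQ (.mix p φ₁ φ₂) →
      (S + R + 1) / (1 - lam * mu / 4 * (1 + |kap|)) ≤ covP (.mix p φ₁ φ₂) →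
      ∀ ψ : ℝ → ℂ, IsSystemState ψ → JointFocusing lam mu kap (.mix p φ₁ φ₂) ψ := by
    intro hk hr p x₁ k₁ x₂ k₂ S R hp hp1 φ₁ φ₂ h₁ h₂ hQ hP ψ hψ
    rw [jointFocusing_mix_iff hlam hmu hp hp1 h₁ h₂ hψ]
    exact mixture_focusing_of_le ht h₁.S_nonneg h₁.R_nonneg hk hr hQ hP
  refine ⟨?_, ?_, ?_, ?_⟩
  · intro a b d hD ψ hψ
    have ha : 0 < a := by simpa using hD.diag_pos (i := 0)
    have hdet : 0 < a * d - b * b := by simpa [Matrix.det_fin_two_of] using hD.det_pos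
    have h1 := twoMode_focusing (kap := kap) hlam hmu ha hdet hψ
    have h2 := twoMode_focusing (kap := kap) (b := -b) (d := d) hlam hmu ha (by linarith) hψ
    refine ⟨h1.1, h1.2, ?_⟩
    rw [h1.2, h2.2, abs_neg]
    constructor
    · rintro (⟨h, -, h'⟩ | ⟨h, -, h'⟩) <;> exact ⟨h, h'⟩
    · rintro ⟨h, h'⟩
      have hb : b ≠ 0 := by
        rintro rfl
        have : 0 ≤ lam * mu / 4 * (1 + |kap|) := by positivity
        simp only [abs_zero, zero_div] at h'
        linarith
      have hk : kap ≠ 0 := by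
        rintro rfl
        norm_num at h
      -- Only the sign of κb distinguishes the states with b and -b, and exactly one choice makes it
      -- positive.
      rcases lt_or_gt_of_ne (mul_ne_zero hk hb) with h3 | h3
      · exact Or.inr ⟨h, by linarith, h'⟩
      · exact Or.inl ⟨h, h3, h'⟩
  · intro p x₁ k₁ x₂ k₂ S R hp hp1 φ₁ φ₂ h₁ h₂
    obtain ⟨q1, q2, q3⟩ := position_mix hp.le hp1.le h₁ h₂
    obtain ⟨r1, r2, r3⟩ := momentum_mix hp.le hp1.le h₁ h₂
    refine ⟨q2, r2, fun ψ hψ =>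
      ⟨focusDefined (gaussianDecay_mix h₁ h₂) q1 r1 hψ hlam.ne' hmu.ne' kap, fun h => ?_⟩⟩
    rw [jointFocusing_mix_iff hlam hmu hp hp1 h₁ h₂ hψ] at h
    have hpp : 0 ≤ p - p ^ 2 := by nlinarith
    exact abs_lt_one_of_mixture_focusing ht h₁.S_nonneg h₁.R_nonneg
      (by rw [q2]; positivity) (by rw [r2]; positivity) h.1 h.2
  · intro hk hr S R
    exact ⟨_, fun p x₁ k₁ x₂ k₂ hp hp1 φ₁ φ₂ h₁ h₂ hQ hP =>
      hlarge hk hr p x₁ k₁ x₂ k₂ S R hp hp1 φ₁ φ₂ h₁ h₂ hQ hP⟩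
  · intro hk hr S R p hp hp1
    have hpp : 0 < p - p ^ 2 := by nlinarith
    -- By this choice, a separation of at least `L` makes (p - p²) times its square at least the
    -- covariance threshold of `hlarge`.
    refine ⟨Real.sqrt ((S + R + 1) / (1 - lam * mu / 4 * (1 + |kap|)) / (p - p ^ 2)),
      fun x₁ k₁ x₂ k₂ φ₁ φ₂ h₁ h₂ hx hk' =>
        hlarge hk hr p x₁ k₁ x₂ k₂ S R hp hp1 φ₁ φ₂ h₁ h₂ ?_ ?_⟩
    · rw [(position_mix hp.le hp1.le h₁ h₂).2.1, ← div_le_iff₀' hpp, ← sq_abs (x₁ - x₂)]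
      exact (Real.sqrt_le_left (abs_nonneg _)).1 hx
    · rw [(momentum_mix hp.le hp1.le h₁ h₂).2.1, ← div_le_iff₀' hpp, ← sq_abs (k₁ - k₂)]
      exact (Real.sqrt_le_left (abs_nonneg _)).1 hk'
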